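/- **Setting.** Let $\Omega\subset\mathbb R^d$ be a bounded domain, $(\cdot,\cdot)$ and $\|\cdot\|$ the $L^2(\Omega)$ inner product and norm, and let $C_\Omega>0$ be a Poincaré–Wirtinger constant: $\|v\|\le C_\Omega\|\nabla v\|$ for all $v\in H^1(\Omega)$ with $\int_\Omega v=0$ (it exists, e.g., if $\partial\Omega$ is Lipschitz). Let $\gamma,\ell,\tau,m,\kappa,M,\alpha>0$ be constants. Assume: * (A1) $\Psi=\Psi_c-\Psi_e\ge 0$ with $\Psi_c,\Psi_e:\mathbb R\to\mathbb R$ convex and differentiable and $\Psi_c'$ Lipschitz with constant $L_{\Psi_c'}$. * (A2) Mobility $m$, permeability $\kappa$, Biot modulus $M$ and Biot–Willis coefficient $\alpha$ are constant and positive. * (A3) $\mathbb C$ is a constant fourth-order tensor with the minor and major symmetries and $c_{\mathbb C}|\varepsilon|^2\le\varepsilon:\mathbb C\varepsilon\le C_{\mathbb C}|\varepsilon|^2$ for symmetric $\varepsilon$, where $c_{\mathbb C},C_{\mathbb C}>0$. * (A4) $\mathcal T:\mathbb R\to\mathbb R^{d\times d}$ has symmetric values, is Lipschitz and differentiable, satisfies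 $c_{\mathcal T}\|\varphi\|\le\|\mathcal T(\varphi)\|\le C_{\mathcal T}\|\varphi\|$ for all $\varphi\in L^2(\Omega)$, with $c_{\mathcal T},C_{\mathcal T}>0$, and is linear. * (A5) $R,S_f\in L^2(\Omega)$ and $f\in L^2(\Omega)^d$. Let $V^{ch},V^{f}\subset H^1(\Omega)$ and $V^{u}\subset H^1_0(\Omega)^d$ be finite-dimensional, with $V^{ch}$ and $V^{f}$ containing the constants, and let $h>0$ (the mesh diameter) and $C_{inv}>0$ satisfy the inverse inequality $\|m^{1/2}\nabla q\|\le C_{inv}h^{-1}\|q\|$ for $q\in V^{ch}$. For $(y,z)\in\{(m,ch),(\kappa,f)\}$ let $V^z_0$ be the functions of $V^z$ of zero mean and put $$\|s\|_{y,z}'=\sup\Big\{\frac{(s,l)}{\|y^{1/2}\nabla l\|}: l\in V^z_0,\ \nabla l\ne 0\Big\}$$ (and $0$ if there is no such $l$). Given $\varphi^{n-1}\in V^{ch}$, $u^{n-1}\in V^u$, $\theta^{n-1}\in V^f$, let $$\bar V^{ch}=\{\varphi\in V^{ch}:\textstyle\int_\Omega\frac{\varphi-\varphi^{n-1}}{\tau}=\int_\Omega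 R\},\qquad \bar V^{f}=\{\theta\in V^{f}:\textstyle\int_\Omega\frac{\theta-\theta^{n-1}}{\tau}=\int_\Omega S_f\},$$ and, with $\varepsilon(u)=\frac12(\nabla u+\nabla u^T)$, $$\begin{aligned}\mathcal H(\varphi,u,\theta)={}&\frac{(\|\varphi-\varphi^{n-1}-\tau R\|_{m,ch}')^2}{2\tau}+\frac{(\|\theta-\theta^{n-1}-\tau S_f\|_{\kappa,f}')^2}{2\tau}+\frac\gamma\ell\int_\Omega\Psi_c(\varphi)\\&+\int_\Omega\frac{\gamma\ell}2|\nabla\varphi|^2+\frac12(\varepsilon(u)-\mathcal T(\varphi)):\mathbb C(\varepsilon(u)-\mathcal T(\varphi))+\frac M2(\theta-\alpha\nabla\cdot u)^2\\&-\frac\gamma\ell(\Psi_e'(\varphi^{n-1}),\varphi)-(f,u).\end{aligned}$$ Let $(\varphi^n,u^n,\theta^n)$ be a minimizer of $\mathcal H$ over $\bar V^{ch}\times V^u\times\bar V^f$. **Alternating minimization.** Start from $(\varphi^{n,0},u^{n,0},\theta^{n,0})=(\varphi^{n-1},u^{n-1},\theta^{n-1})$. For $i\ge1$, first $\varphi^{n,i},\mu^{n,i}\in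 V^{ch}$ solve (Cahn–Hilliard step) $$(\varphi^{n,i}-\varphi^{n-1},\eta)+\tau(m\nabla\mu^{n,i},\nabla\eta)-\tau(R,\eta)=0,$$ $$(\mu^{n,i},\eta)-\gamma\Big(\ell(\nabla\varphi^{n,i},\nabla\eta)+\tfrac1\ell(\Psi_c'(\varphi^{n,i})-\Psi_e'(\varphi^{n-1}),\eta)\Big)+\big(\mathcal T'(\varphi^{n,i}):\mathbb C(\varepsilon(u^{n,i-1})-\mathcal T(\varphi^{n,i})),\eta\big)=0$$ for all $\eta\in V^{ch}$; then $u^{n,i}\in V^u$, $\theta^{n,i},p^{n,i}\in V^f$ solve (Biot step) $$(\mathbb C(\varepsilon(u^{n,i})-\mathcal T(\varphi^{n,i})),\varepsilon(\eta))-(\alpha M(\theta^{n,i}-\alpha\nabla\cdot u^{n,i}),\nabla\cdot\eta)-(f,\eta)=0\quad\forall\eta\in V^u,$$ $$(\theta^{n,i}-\theta^{n-1},\eta)+\tau(\kappa\nabla p^{n,i},\nabla\eta)-\tau(S_f,\eta)=0,\qquad (p^{n,i},\eta)-(M(\theta^{n,i}-\alpha\nabla\cdot u^{n,i}),\eta)=0\quad\forall\eta\in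 V^f.$$ **Theorem.** For every $i\ge2$, $$\mathcal H(\varphi^{n,i},u^{n,i},\theta^{n,i})-\mathcal H(\varphi^n,u^n,\theta^n)\le\Big(1-\frac{\beta_{ch}}{L_{ch}}\Big)(1-\beta_b)\Big(\mathcal H(\varphi^{n,i-1},u^{n,i-1},\theta^{n,i-1})-\mathcal H(\varphi^n,u^n,\theta^n)\Big),$$ where $$\beta_{ch}=\beta_b=1-\Big(\frac{h^2}{\tau C_{inv}^2C_{\mathbb C}C_{\mathcal T}^2}+\frac{\gamma\ell}{C_\Omega^2C_{\mathbb C}C_{\mathcal T}^2}+1\Big)^{-1},$$ $$L_{ch}=1+\frac\gamma\ell L_{\Psi_c'}\Big(\frac1\tau\frac{h^2}{C_{inv}^2}+\gamma\ell\frac1{C_\Omega^2}+c_{\mathbb C}c_{\mathcal T}^2\Big)^{-1}.$$ The inequality also holds for $i=1$ if the initial state is consistent, that is, if $\varphi^{n-1}\in\bar V^{ch}$ and $(u^{n-1},\theta^{n-1})$, with some $p\in V^f$, solves the Biot step for the phase field $\varphi^{n-1}$. -/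

import Mathlib

open MeasureTheory Set
open scoped ContDiff NNReal

noncomputable section

namespace CHB

/-- Points of `ℝ^d` with the Euclidean norm. -/
abbrev Pt (d : ℕ) : Type := EuclideanSpace ℝ (Fin d)

/-- `L²(Ω; E)`. -/
abbrev L2 {d : ℕ} (Ω : Set (Pt d)) (E : Type) [NormedAddCommGroup E] : Type :=
  Lp E 2 (volume.restrict Ω)

/-- A pair `w = (v, g)` with `v ∈ L²(Ω)` and `g ∈ L²(Ω)^d`. Elements of `H¹(Ω)` are represented
as pairs `(v, ∇v)`: the function is `w.1` and its weak gradient is `w.2`. -/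
abbrev FunGrad {d : ℕ} (Ω : Set (Pt d)) : Type := L2 Ω ℝ × L2 Ω (Pt d)

/-- A `d`-tuple of pairs, for vector fields `u = (u_1, …, u_d)` with the gradients of the
components. -/
abbrev VecFunGrad {d : ℕ} (Ω : Set (Pt d)) : Type := Fin d → FunGrad Ω

/-- `ψ ∈ C_c^∞(Ω)`. -/
structure IsTestFunction {d : ℕ} (Ω : Set (Pt d)) (ψ : Pt d → ℝ) : Prop where
  smooth : ContDiff ℝ ∞ ψ
  compact : HasCompactSupport ψ
  supp : tsupport ψ ⊆ Ω

/-- `H¹(Ω)`: the pairs `(v, g)` in which `g` is the weak gradient of `v`. -/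
def H1 {d : ℕ} (Ω : Set (Pt d)) : Set (FunGrad Ω) :=
  {w | ∀ ψ : Pt d → ℝ, IsTestFunction Ω ψ →
    (∫ x in Ω, w.1 x • gradient ψ x) = - (∫ x in Ω, ψ x • w.2 x)}

/-- `H¹_0(Ω)`: the closure of `C_c^∞(Ω)` in the topology of `H¹(Ω)`. -/
def H10 {d : ℕ} (Ω : Set (Pt d)) : Set (FunGrad Ω) :=
  closure {w | ∃ ψ : Pt d → ℝ, IsTestFunction Ω ψ ∧
    (w.1 : Pt d → ℝ) =ᵐ[volume.restrict Ω] ψ ∧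
    (w.2 : Pt d → Pt d) =ᵐ[volume.restrict Ω] gradient ψ}

/-- `d × d` tensors. -/
abbrev Tensor (d : ℕ) : Type := Matrix (Fin d) (Fin d) ℝ

/-- The double contraction `A : B`. -/
def ddot {d : ℕ} (A B : Tensor d) : ℝ := ∑ i, ∑ j, A i j * B i j

/-- The action `(ℂ A)_{ij} = ∑_{k,l} ℂ_{ijkl} A_{kl}` of a fourth-order tensor. -/
def stiff {d : ℕ} (C : Fin d → Fin d → Fin d → Fin d → ℝ) (A : Tensor d) : Tensor d :=
  Matrix.of fun i j => ∑ k, ∑ l, C i j k l * A k l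

/-- The linearized strain `ε(u) = (∇u + ∇uᵀ)/2` at the point `x`. -/
def strain {d : ℕ} {Ω : Set (Pt d)} (u : VecFunGrad Ω) (x : Pt d) : Tensor d :=
  Matrix.of fun i j => ((u i).2 x j + (u j).2 x i) / 2

/-- The divergence `∇ · u = tr ε(u)` at the point `x`. -/
def dvg {d : ℕ} {Ω : Set (Pt d)} (u : VecFunGrad Ω) (x : Pt d) : ℝ := (strain u x).trace

/-- The entrywise derivative `T'(s)` of a tensor-valued function of a real variable. -/
def tensorDeriv {d : ℕ} (T : ℝ → Tensor d) (s : ℝ) : Tensor d :=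
  Matrix.of fun i j => deriv (fun r => T r i j) s

/-- The mean-free part `V_{h,0}` of a discrete space `V_h`. -/
def meanFree {d : ℕ} {Ω : Set (Pt d)} (V : Submodule ℝ (FunGrad Ω)) : Set (FunGrad Ω) :=
  {l | l ∈ V ∧ (∫ x in Ω, l.1 x) = 0}

/-- The dual norm, with respect to `‖y^{1/2} ∇ · ‖` on the mean-free functions of `V`, of the
functional `l ↦ (s, l)`. -/
def dualNorm {d : ℕ} {Ω : Set (Pt d)} (V : Submodule ℝ (FunGrad Ω)) (y : ℝ) (s : L2 Ω ℝ) : ℝ :=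
  sSup {r | ∃ l ∈ meanFree V, √y * ‖l.2‖ ≠ 0 ∧ r = inner ℝ s l.1 / (√y * ‖l.2‖)}

/-- The data of one time step: physical parameters, discrete spaces, sources, and the solution
of the previous time step. -/
structure Problem {d : ℕ} (Ω : Set (Pt d)) where
  /-- surface tension -/
  γ : ℝ
  /-- regularization parameter -/
  ℓ : ℝ
  /-- time-step size -/
  τ : ℝ
  /-- mobility -/
  m : ℝ
  /-- permeability -/
  κ : ℝ
  /-- Biot modulus -/
  M : ℝ
  /-- Biot-Willis coefficient -/
  α : ℝ
  /-- stiffness tensor -/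
  C : Fin d → Fin d → Fin d → Fin d → ℝ
  /-- eigenstrain -/
  T : ℝ → Tensor d
  /-- the double-well potential is `Ψc - Ψe` -/
  Ψc : ℝ → ℝ
  Ψe : ℝ → ℝ
  /-- discrete spaces for phase field, displacement, and flow -/
  Vch : Submodule ℝ (FunGrad Ω)
  Vu : Submodule ℝ (VecFunGrad Ω)
  Vf : Submodule ℝ (FunGrad Ω)
  /-- reaction term, body force, fluid source -/
  R : L2 Ω ℝ
  f : Fin d → L2 Ω ℝ
  S : L2 Ω ℝ
  /-- solution of the previous time step -/
  φprev : FunGrad Ω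
  uprev : VecFunGrad Ω
  θprev : FunGrad Ω

/-- Assumption on the potential: `Ψ = Ψc - Ψe ≥ 0` with `Ψc`, `Ψe` convex and differentiable and
`Ψc'` Lipschitz continuous with constant `L`. -/
structure PotentialAssumption (Ψc Ψe : ℝ → ℝ) (L : ℝ≥0) : Prop where
  nonneg : ∀ s, 0 ≤ Ψc s - Ψe s
  convex_c : ConvexOn ℝ univ Ψc
  convex_e : ConvexOn ℝ univ Ψe
  diff_c : Differentiable ℝ Ψc
  diff_e : Differentiable ℝ Ψe
  lipschitz : LipschitzWith L (deriv Ψc)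

/-- Assumption on the stiffness tensor: minor and major symmetries, and
`c |ε|² ≤ ε : ℂ ε ≤ C |ε|²` on symmetric tensors. -/
structure StiffnessAssumption {d : ℕ} (C : Fin d → Fin d → Fin d → Fin d → ℝ) (cC CC : ℝ) :
    Prop where
  pos_lower : 0 < cC
  pos_upper : 0 < CC
  minor_left : ∀ i j k l, C i j k l = C j i k l
  minor_right : ∀ i j k l, C i j k l = C i j l k
  major : ∀ i j k l, C i j k l = C k l i j
  lower : ∀ A : Tensor d, A.IsSymm → cC * ddot A A ≤ ddot A (stiff C A)
  upper : ∀ A : Tensor d, A.IsSymm → ddot A (stiff C A) ≤ CC * ddot A A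

/-- Assumption on the eigenstrain: symmetric, Lipschitz continuous, differentiable, bounded from
below and above in `L²(Ω)`, and linear. -/
structure EigenstrainAssumption {d : ℕ} (Ω : Set (Pt d)) (T : ℝ → Tensor d) (cT CT : ℝ) :
    Prop where
  pos_lower : 0 < cT
  pos_upper : 0 < CT
  symm : ∀ s, (T s).IsSymm
  lipschitz : ∃ K : ℝ, ∀ s r, √(ddot (T s - T r) (T s - T r)) ≤ K * |s - r|
  diff : ∀ i j, Differentiable ℝ fun s => T s i j
  lower : ∀ v : L2 Ω ℝ, cT * ‖v‖ ≤ √(∫ x in Ω, ddot (T (v x)) (T (v x)))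
  upper : ∀ v : L2 Ω ℝ, √(∫ x in Ω, ddot (T (v x)) (T (v x))) ≤ CT * ‖v‖
  linear : IsLinearMap ℝ T

/-- The space contains the constant functions. -/
def ContainsConstants {d : ℕ} {Ω : Set (Pt d)} (V : Submodule ℝ (FunGrad Ω)) : Prop :=
  ∃ e ∈ V, (e.1 : Pt d → ℝ) =ᵐ[volume.restrict Ω] (fun _ => (1 : ℝ)) ∧ e.2 = 0

/-- `c` is a Poincaré-Wirtinger constant of `Ω`. -/
def IsPoincareConstant {d : ℕ} (Ω : Set (Pt d)) (c : ℝ) : Prop :=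
  0 < c ∧ ∀ w ∈ H1 Ω, (∫ x in Ω, w.1 x) = 0 → ‖w.1‖ ≤ c * ‖w.2‖

/-- `c` is the constant of the inverse inequality
`‖y^{1/2} ∇q‖ ≤ c h⁻¹ ‖q‖` on the discrete space `V` with mesh diameter `h`. -/
def IsInverseConstant {d : ℕ} {Ω : Set (Pt d)} (V : Submodule ℝ (FunGrad Ω)) (y h c : ℝ) : Prop :=
  0 < c ∧ ∀ q ∈ V, √y * ‖q.2‖ ≤ c / h * ‖q.1‖

namespace Problem

variable {d : ℕ} {Ω : Set (Pt d)} (P : Problem Ω)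

/-- The scalar parameters are positive. -/
structure PositiveParameters : Prop where
  γ : 0 < P.γ
  ℓ : 0 < P.ℓ
  τ : 0 < P.τ
  m : 0 < P.m
  κ : 0 < P.κ
  M : 0 < P.M
  α : 0 < P.α

/-- The discrete spaces are finite-dimensional conforming subspaces of `H¹(Ω)`, `H¹_0(Ω)^d` and
`H¹(Ω)`, the scalar ones containing the constants, and the previous solution is discrete. -/
structure Conforming : Prop where
  fin_ch : FiniteDimensional ℝ P.Vch
  fin_u : FiniteDimensional ℝ P.Vu
  fin_f : FiniteDimensional ℝ P.Vf
  sub_ch : ∀ w ∈ P.Vch, w ∈ H1 Ω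
  sub_u : ∀ w ∈ P.Vu, ∀ i, w i ∈ H10 Ω
  sub_f : ∀ w ∈ P.Vf, w ∈ H1 Ω
  const_ch : ContainsConstants P.Vch
  const_f : ContainsConstants P.Vf
  φprev : P.φprev ∈ P.Vch
  uprev : P.uprev ∈ P.Vu
  θprev : P.θprev ∈ P.Vf

/-- The affine space of phase fields with the prescribed mass balance. -/
def VchBar : Set (FunGrad Ω) :=
  {φ | φ ∈ P.Vch ∧ (∫ x in Ω, (φ.1 x - P.φprev.1 x) / P.τ) = ∫ x in Ω, P.R x}

/-- The affine space of fluid contents with the prescribed mass balance. -/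
def VfBar : Set (FunGrad Ω) :=
  {θ | θ ∈ P.Vf ∧ (∫ x in Ω, (θ.1 x - P.θprev.1 x) / P.τ) = ∫ x in Ω, P.S x}

/-- The elastic stress `ℂ (ε(u) - T(φ))` at the point `x`. -/
def stress (φ : FunGrad Ω) (u : VecFunGrad Ω) (x : Pt d) : Tensor d :=
  stiff P.C (strain u x - P.T (φ.1 x))

/-- The quadratic part of the energy. -/
def Equad (φ : FunGrad Ω) (u : VecFunGrad Ω) (θ : FunGrad Ω) : ℝ :=
  ∫ x in Ω, (P.γ * P.ℓ / 2 * ‖φ.2 x‖ ^ 2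
    + 1 / 2 * ddot (strain u x - P.T (φ.1 x)) (stiff P.C (strain u x - P.T (φ.1 x)))
    + P.M / 2 * (θ.1 x - P.α * dvg u x) ^ 2)

/-- The convex energy. -/
def Ec (φ : FunGrad Ω) (u : VecFunGrad Ω) (θ : FunGrad Ω) : ℝ :=
  P.Equad φ u θ + P.γ / P.ℓ * (∫ x in Ω, P.Ψc (φ.1 x))

/-- The potential `H_τ^n`. -/
def H (φ : FunGrad Ω) (u : VecFunGrad Ω) (θ : FunGrad Ω) : ℝ :=
  dualNorm P.Vch P.m (φ.1 - P.φprev.1 - P.τ • P.R) ^ 2 / (2 * P.τ)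
    + P.Ec φ u θ
    + dualNorm P.Vf P.κ (θ.1 - P.θprev.1 - P.τ • P.S) ^ 2 / (2 * P.τ)
    - P.γ / P.ℓ * (∫ x in Ω, deriv P.Ψe (P.φprev.1 x) * φ.1 x)
    - ∑ i, inner ℝ (P.f i) (u i).1

/-- `(φ, u, θ)` minimizes `H_τ^n` over the admissible discrete states. -/
structure IsMinimizer (φ : FunGrad Ω) (u : VecFunGrad Ω) (θ : FunGrad Ω) : Prop where
  φ_mem : φ ∈ P.VchBar
  u_mem : u ∈ P.Vu
  θ_mem : θ ∈ P.VfBar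
  min : ∀ φ' ∈ P.VchBar, ∀ u' ∈ P.Vu, ∀ θ' ∈ P.VfBar, P.H φ u θ ≤ P.H φ' u' θ'

/-- The Cahn-Hilliard step: `(φ, μ)` solves the discrete Cahn-Hilliard subproblem with frozen
displacement `u`. -/
structure IsChStep (u : VecFunGrad Ω) (φ μ : FunGrad Ω) : Prop where
  φ_mem : φ ∈ P.Vch
  μ_mem : μ ∈ P.Vch
  balance : ∀ η ∈ P.Vch,
    inner ℝ (φ.1 - P.φprev.1) η.1 + P.τ * (P.m * inner ℝ μ.2 η.2) - P.τ * inner ℝ P.R η.1 = 0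
  chemical : ∀ η ∈ P.Vch,
    inner ℝ μ.1 η.1
      - P.γ * (P.ℓ * inner ℝ φ.2 η.2
        + 1 / P.ℓ * (∫ x in Ω, (deriv P.Ψc (φ.1 x) - deriv P.Ψe (P.φprev.1 x)) * η.1 x))
      + (∫ x in Ω, ddot (tensorDeriv P.T (φ.1 x)) (P.stress φ u x) * η.1 x) = 0

/-- The Biot step: `(u, θ, p)` solves the discrete Biot subproblem with frozen phase field
`φ`. -/
structure IsBiotStep (φ : FunGrad Ω) (u : VecFunGrad Ω) (θ p : FunGrad Ω) : Prop where
  u_mem : u ∈ P.Vu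
  θ_mem : θ ∈ P.Vf
  p_mem : p ∈ P.Vf
  elasticity : ∀ η ∈ P.Vu,
    (∫ x in Ω, ddot (P.stress φ u x) (strain η x))
      - (∫ x in Ω, P.α * P.M * (θ.1 x - P.α * dvg u x) * dvg η x)
      - ∑ i, inner ℝ (P.f i) (η i).1 = 0
  flow : ∀ η ∈ P.Vf,
    inner ℝ (θ.1 - P.θprev.1) η.1 + P.τ * (P.κ * inner ℝ p.2 η.2) - P.τ * inner ℝ P.S η.1 = 0
  pressure : ∀ η ∈ P.Vf,
    inner ℝ p.1 η.1 - (∫ x in Ω, P.M * (θ.1 x - P.α * dvg u x) * η.1 x) = 0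

/-- The iterates of the alternating minimization scheme, initialized with the previous time
step. The auxiliary variables `μ 0` and `p 0` play no role. -/
structure IsAlternating (φ μ : ℕ → FunGrad Ω) (u : ℕ → VecFunGrad Ω) (θ p : ℕ → FunGrad Ω) :
    Prop where
  φ_init : φ 0 = P.φprev
  u_init : u 0 = P.uprev
  θ_init : θ 0 = P.θprev
  ch : ∀ i, 1 ≤ i → P.IsChStep (u (i - 1)) (φ i) (μ i)
  biot : ∀ i, 1 ≤ i → P.IsBiotStep (φ i) (u i) (θ i) (p i)

/-- The constant `β_ch = β_b`. -/
def beta (h Cinv CΩ CC CT : ℝ) : ℝ :=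
  1 - (h ^ 2 / (P.τ * Cinv ^ 2 * CC * CT ^ 2) + P.γ * P.ℓ / (CΩ ^ 2 * CC * CT ^ 2) + 1)⁻¹

/-- The constant `L_ch`. -/
def Lch (h Cinv CΩ cC cT L : ℝ) : ℝ :=
  1 + P.γ / P.ℓ * L *
    (1 / P.τ * (h ^ 2 / Cinv ^ 2) + P.γ * P.ℓ * (1 / CΩ ^ 2) + cC * cT ^ 2)⁻¹

end Problem

end CHB

end

/-!
The scheme is a two-block exact minimization of the convex potential `H`: the Cahn-Hilliard step
minimizes `H` over the phase field, the Biot step over displacement and fluid content. Along a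
line, `H` is quadratic up to the Taylor remainder of `Ψc`, which lies between `0` and
`L / 2` times the squared `L²` norm of the increment (`H_add_smul`). The dual norms enter the
quadratic part because their squares are `y ‖∇g‖²`, where `g` is the Riesz representative of the
functional, a discrete Neumann potential (`IsPotentialOf`); in the two substeps these
representatives are the mean-free parts of `-τ μ` and `-τ p`, so that the discrete equations are
exactly the Euler-Lagrange equations of the two blocks (`IsChStep.exists_chDeriv_eq_zero`,
`IsBiotStep.exists_biotDeriv_eq_zero`).

The rate comes from comparing the joint quadratic energy `Q` with its restrictions to the two
blocks. By the inverse and Poincaré inequalities, the diffusive part of the phase-field energy is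
at least `K` times the eigenstrain energy `∫ T(φ) : ℂ T(φ) / 2`. Discarding the elastic energy, or
completing the square in it, shows that `Q` is at least `β = K / (K + 1)` times the energy of
either block (`beta_mul_phase_le`, `beta_mul_biot_le`). In the phase field, `H` is smooth with
constant `L_ch` relative to the block energy (`phase_add_le_Lch_mul`); in the Biot block it is
quadratic, with constant `1`.

If one block is already optimal, only the derivative `a` in the other block survives, and any
competitor satisfies `H* ≥ H + a + β N`, with `N` the block energy of the increment towards it.
The exact minimizer of the block is at least as good as the point at distance `β / L` towards the
competitor, which gains the fraction `β / L` of the energy gap (`sub_le_of_block_step`). Applied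
to the two substeps, this gives the product of the two factors. The state before a full iteration
has to be Biot-optimal, which is why the first iteration needs a consistent initial state.
-/

noncomputable section

/-! ### Discrete dual norms -/

namespace CHB

lemma surjective_of_injective_to_dual {W : Type*} [AddCommGroup W] [Module ℝ W]
    [FiniteDimensional ℝ W] {b : W →ₗ[ℝ] Module.Dual ℝ W} (hb : Function.Injective b) :
    Function.Surjective b :=
  (LinearMap.injective_iff_surjective_of_finrank_eq_finrank Subspace.dual_finrank_eq.symm).1 hb

section DualNorm

variable {d : ℕ} {Ω : Set (Pt d)}

lemma L2.integrable {E : Type} [NormedAddCommGroup E] [IsFiniteMeasure (volume.restrict Ω)]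
    (v : L2 Ω E) : Integrable v (volume.restrict Ω) :=
  (Lp.memLp v).integrable (by norm_num)

/-- The integral over `Ω` of the function component, as a linear functional. -/
def total (Ω : Set (Pt d)) [IsFiniteMeasure (volume.restrict Ω)] : FunGrad Ω →ₗ[ℝ] ℝ where
  toFun w := ∫ x in Ω, w.1 x
  map_add' v w := by
    rw [← integral_add (L2.integrable v.1) (L2.integrable w.1)]
    exact integral_congr_ae (Lp.coeFn_add v.1 w.1)
  map_smul' c v := by
    rw [RingHom.id_apply, smul_eq_mul, ← integral_const_mul]
    exact integral_congr_ae (Lp.coeFn_smul c v.1)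

/-- `meanFree V` as a linear subspace. -/
def meanFreeSubmodule [IsFiniteMeasure (volume.restrict Ω)] (V : Submodule ℝ (FunGrad Ω)) :
    Submodule ℝ (FunGrad Ω) :=
  V ⊓ LinearMap.ker (total Ω)

lemma mem_meanFreeSubmodule [IsFiniteMeasure (volume.restrict Ω)]
    {V : Submodule ℝ (FunGrad Ω)} {l : FunGrad Ω} :
    l ∈ meanFreeSubmodule V ↔ l ∈ meanFree V := Iff.rfl

/-- `g` is a discrete solution of the Neumann problem `-y Δ g = s` on the mean-free functions
of `V`, that is, the Riesz representative of `l ↦ (s, l)` for the inner product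
`y (∇·, ∇·)`. -/
def IsPotentialOf (V : Submodule ℝ (FunGrad Ω)) (y : ℝ) (s : L2 Ω ℝ) (g : FunGrad Ω) : Prop :=
  g ∈ meanFree V ∧ ∀ l ∈ meanFree V, y * inner ℝ g.2 l.2 = inner ℝ s l.1

variable {V : Submodule ℝ (FunGrad Ω)} {y : ℝ}

lemma IsPotentialOf.dualNorm_sq (hy : 0 < y) {s : L2 Ω ℝ} {g : FunGrad Ω}
    (hg : IsPotentialOf V y s g) : dualNorm V y s ^ 2 = y * ‖g.2‖ ^ 2 := by
  have hsy : 0 < √y := Real.sqrt_pos.2 hy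
  have hyy : √y * √y = y := Real.mul_self_sqrt hy.le
  have key : dualNorm V y s = √y * ‖g.2‖ := by
    by_cases h0 : g.2 = 0
    · rw [h0, norm_zero, mul_zero]
      have hsub : {r | ∃ l ∈ meanFree V, √y * ‖l.2‖ ≠ 0 ∧
          r = inner ℝ s l.1 / (√y * ‖l.2‖)} ⊆ {0} := by
        rintro r ⟨l, hl, -, rfl⟩
        rw [mem_singleton_iff, ← hg.2 l hl, h0]
        simp
      rcases subset_singleton_iff_eq.1 hsub with h | h <;> rw [dualNorm, h] <;> simp
    · have hn : 0 < ‖g.2‖ := norm_pos_iff.2 h0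
      refine IsGreatest.csSup_eq ⟨⟨g, hg.1, (mul_pos hsy hn).ne', ?_⟩, ?_⟩
      · rw [← hg.2 g hg.1, real_inner_self_eq_norm_sq, eq_div_iff (mul_pos hsy hn).ne']
        linear_combination ‖g.2‖ ^ 2 * hyy
      · rintro r ⟨l, hl, hl0, rfl⟩
        have hlp : 0 < √y * ‖l.2‖ := lt_of_le_of_ne (by positivity) (Ne.symm hl0)
        rw [← hg.2 l hl, div_le_iff₀ hlp]
        have := mul_le_mul_of_nonneg_left (real_inner_le_norm g.2 l.2) hy.le
        calc y * inner ℝ g.2 l.2 ≤ y * (‖g.2‖ * ‖l.2‖) := this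
          _ = √y * ‖g.2‖ * (√y * ‖l.2‖) := by
            linear_combination -(‖g.2‖ * ‖l.2‖) * hyy
  rw [key, mul_pow, Real.sq_sqrt hy.le]

lemma IsPotentialOf.add_smul [IsFiniteMeasure (volume.restrict Ω)] {s s' : L2 Ω ℝ}
    {g g' : FunGrad Ω} (hg : IsPotentialOf V y s g) (hg' : IsPotentialOf V y s' g') (t : ℝ) :
    IsPotentialOf V y (s + t • s') (g + t • g') := by
  refine ⟨mem_meanFreeSubmodule.1 (add_mem (mem_meanFreeSubmodule.2 hg.1)
    (Submodule.smul_mem _ t (mem_meanFreeSubmodule.2 hg'.1))), fun l hl => ?_⟩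
  simp only [Prod.snd_add, Prod.smul_snd, inner_add_left, real_inner_smul_left]
  rw [← hg.2 l hl, ← hg'.2 l hl]
  ring

/-- The squared dual norm is a quadratic form whose gradient at `s` is given by the potential
of `s`. -/
lemma IsPotentialOf.dualNorm_sq_add_smul [IsFiniteMeasure (volume.restrict Ω)] (hy : 0 < y)
    {s : L2 Ω ℝ} {g w g' : FunGrad Ω} (hg : IsPotentialOf V y s g)
    (hg' : IsPotentialOf V y w.1 g') (t : ℝ) :
    dualNorm V y (s + t • w.1) ^ 2 =
      dualNorm V y s ^ 2 + 2 * t * inner ℝ w.1 g.1 + t ^ 2 * dualNorm V y w.1 ^ 2 := by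
  rw [(hg.add_smul hg' t).dualNorm_sq hy, hg.dualNorm_sq hy, hg'.dualNorm_sq hy,
    ← hg'.2 g hg.1]
  simp only [Prod.snd_add, Prod.smul_snd]
  rw [norm_add_sq_real, real_inner_smul_right, norm_smul, mul_pow, Real.norm_eq_abs, sq_abs,
    real_inner_comm]
  ring

lemma isPotentialOf_zero [IsFiniteMeasure (volume.restrict Ω)] : IsPotentialOf V y 0 0 :=
  ⟨mem_meanFreeSubmodule.1 (zero_mem _), fun l _ => by simp⟩

lemma dualNorm_zero_sq [IsFiniteMeasure (volume.restrict Ω)] (hy : 0 < y) :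
    dualNorm V y 0 ^ 2 = 0 := by
  rw [isPotentialOf_zero.dualNorm_sq hy]; simp

/-- Discrete Neumann problems are solvable: the Poincaré inequality makes `y (∇·, ∇·)` positive
definite on the finite-dimensional mean-free space. -/
lemma exists_isPotentialOf [IsFiniteMeasure (volume.restrict Ω)] [FiniteDimensional ℝ V]
    (hV : ∀ w ∈ V, w ∈ H1 Ω) {c : ℝ} (hc : IsPoincareConstant Ω c) (hy : 0 < y) (s : L2 Ω ℝ) :
    ∃ g, IsPotentialOf V y s g := by
  let V₀ := meanFreeSubmodule V
  have : FiniteDimensional ℝ V₀ := Submodule.finiteDimensional_of_le inf_le_left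
  let b : V₀ →ₗ[ℝ] Module.Dual ℝ V₀ := LinearMap.mk₂ ℝ
    (fun g l => y * inner ℝ g.1.2 l.1.2)
    (fun _ _ _ => by simp [inner_add_left, mul_add])
    (fun _ _ _ => by simp [real_inner_smul_left]; ring)
    (fun _ _ _ => by simp [inner_add_right, mul_add])
    (fun _ _ _ => by simp [real_inner_smul_right]; ring)
  let r : Module.Dual ℝ V₀ :=
    { toFun := fun l => inner ℝ s l.1.1
      map_add' := fun _ _ => by simp [inner_add_right]
      map_smul' := fun _ _ => by simp [real_inner_smul_right] }
  have hinj : Function.Injective b := by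
    rw [injective_iff_map_eq_zero]
    intro g hg
    have h1 : y * inner ℝ g.1.2 g.1.2 = 0 := LinearMap.congr_fun hg g
    have h2 : g.1.2 = 0 := by simpa [hy.ne'] using h1
    have h3 := hc.2 g.1 (hV _ g.2.1) g.2.2
    rw [h2, norm_zero, mul_zero] at h3
    exact Subtype.ext (Prod.ext (norm_le_zero_iff.1 h3) h2)
  obtain ⟨g, hg⟩ := surjective_of_injective_to_dual hinj r
  exact ⟨g.1, mem_meanFreeSubmodule.1 g.2, fun l hl => LinearMap.congr_fun hg ⟨l, hl⟩⟩

/-- The inverse inequality bounds the dual norm of a mean-free discrete function from below. -/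
lemma IsPotentialOf.le_dualNorm_sq (hy : 0 < y) {h c : ℝ} (hh : 0 < h)
    (hinv : IsInverseConstant V y h c) {w g : FunGrad Ω} (hw : w ∈ meanFree V)
    (hg : IsPotentialOf V y w.1 g) : h ^ 2 / c ^ 2 * ‖w.1‖ ^ 2 ≤ dualNorm V y w.1 ^ 2 := by
  obtain ⟨hc, hq⟩ := hinv
  have hyy : √y * √y = y := Real.mul_self_sqrt hy.le
  have h1 := hg.2 w hw
  rw [real_inner_self_eq_norm_sq] at h1
  have h2 : ‖w.1‖ ^ 2 ≤ √y * ‖g.2‖ * (c / h * ‖w.1‖) := by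
    calc ‖w.1‖ ^ 2 = y * inner ℝ g.2 w.2 := h1.symm
      _ ≤ y * (‖g.2‖ * ‖w.2‖) := mul_le_mul_of_nonneg_left (real_inner_le_norm _ _) hy.le
      _ = √y * ‖g.2‖ * (√y * ‖w.2‖) := by linear_combination -(‖g.2‖ * ‖w.2‖) * hyy
      _ ≤ √y * ‖g.2‖ * (c / h * ‖w.1‖) :=
        mul_le_mul_of_nonneg_left (hq w hw.1) (by positivity)
  have h3 : h / c * ‖w.1‖ ≤ √y * ‖g.2‖ := by
    rcases eq_or_lt_of_le (norm_nonneg w.1) with h0 | h0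
    · rw [← h0, mul_zero]; positivity
    · have h4 : ‖w.1‖ ≤ √y * ‖g.2‖ * (c / h) := le_of_mul_le_mul_right (by nlinarith) h0
      calc h / c * ‖w.1‖ ≤ h / c * (√y * ‖g.2‖ * (c / h)) :=
            mul_le_mul_of_nonneg_left h4 (by positivity)
        _ = √y * ‖g.2‖ := by field_simp
  calc h ^ 2 / c ^ 2 * ‖w.1‖ ^ 2 = (h / c * ‖w.1‖) ^ 2 := by ring
    _ ≤ (√y * ‖g.2‖) ^ 2 := pow_le_pow_left₀ (by positivity) h3 2
    _ = dualNorm V y w.1 ^ 2 := by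
      rw [hg.dualNorm_sq hy, mul_pow, Real.sq_sqrt hy.le]

lemma ContainsConstants.inner_eq {e : FunGrad Ω}
    (he : (e.1 : Pt d → ℝ) =ᵐ[volume.restrict Ω] fun _ => (1 : ℝ)) (v : L2 Ω ℝ) :
    inner ℝ v e.1 = ∫ x in Ω, v x := by
  rw [L2.inner_def]
  refine integral_congr_ae ?_
  filter_upwards [he] with x hx
  simp [hx]

/-- A discrete mass balance `(s, η) + τ y (∇μ, ∇η) = 0` exhibits `-τ` times the mean-free part
of `μ` as the potential of `s`. -/
lemma exists_isPotentialOf_of_balance [IsFiniteMeasure (volume.restrict Ω)]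
    (hΩ : (volume.restrict Ω).real univ ≠ 0) (hV : ContainsConstants V) {τ : ℝ} {s : L2 Ω ℝ}
    {ν : FunGrad Ω} (hν : ν ∈ V)
    (hbal : ∀ η ∈ V, inner ℝ s η.1 + τ * (y * inner ℝ ν.2 η.2) = 0) :
    ∃ g, IsPotentialOf V y s g ∧
      ∀ w ∈ meanFree V, inner ℝ w.1 g.1 = -τ * inner ℝ ν.1 w.1 := by
  obtain ⟨e, heV, he, he2⟩ := hV
  have hw0 : ∀ w ∈ meanFree V, inner ℝ w.1 e.1 = 0 := fun w hw => by
    rw [ContainsConstants.inner_eq he]; exact hw.2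
  have htot : total Ω e = (volume.restrict Ω).real univ := by
    change ∫ x in Ω, e.1 x = _
    rw [integral_congr_ae he]; simp
  set k := total Ω ν / total Ω e with hk
  have hke : k * total Ω e = total Ω ν := div_mul_cancel₀ _ (by rw [htot]; exact hΩ)
  have hg : (-τ) • (ν - k • e) ∈ meanFreeSubmodule V := by
    refine Submodule.smul_mem _ _ ⟨sub_mem hν (Submodule.smul_mem _ _ heV), ?_⟩
    change total Ω (ν - k • e) = 0
    rw [map_sub, map_smul, smul_eq_mul, hke, sub_self]
  refine ⟨(-τ) • (ν - k • e), ⟨mem_meanFreeSubmodule.1 hg, fun l hl => ?_⟩, fun w hw => ?_⟩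
  · have := hbal l hl.1
    simp only [Prod.smul_snd, Prod.snd_sub, he2, smul_zero, sub_zero, real_inner_smul_left]
    linarith
  · simp only [Prod.smul_fst, Prod.fst_sub, real_inner_smul_right, inner_sub_right, hw0 w hw]
    rw [real_inner_comm]; ring

end DualNorm

end CHB

/-! ### The potential -/

namespace CHB

lemma tangent_le_of_convexOn {f : ℝ → ℝ} (hf : ConvexOn ℝ univ f) (hd : Differentiable ℝ f)
    (a b : ℝ) : f a + deriv f a * (b - a) ≤ f b := by
  rcases lt_trichotomy a b with h | h | h
  · have := hf.le_slope_of_hasDerivAt (mem_univ a) (mem_univ b) h (hd a).hasDerivAt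
    rw [slope_def_field, le_div_iff₀ (sub_pos.2 h)] at this
    linarith
  · simp [h]
  · have := hf.slope_le_of_hasDerivAt (mem_univ b) (mem_univ a) h (hd a).hasDerivAt
    rw [slope_def_field, div_le_iff₀ (sub_pos.2 h)] at this
    linarith

/-- A function whose derivative is `L`-Lipschitz lies below its tangent parabolas: subtracting
`L/2 s²` makes it concave. -/
lemma le_tangent_add_sq {f : ℝ → ℝ} {L : ℝ≥0} (hd : Differentiable ℝ f)
    (hL : LipschitzWith L (deriv f)) (a b : ℝ) :
    f b ≤ f a + deriv f a * (b - a) + L / 2 * (b - a) ^ 2 := by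
  have hder : ∀ s, HasDerivAt (fun s => (L : ℝ) / 2 * s ^ 2 - f s) (L * s - deriv f s) s := by
    intro s
    refine (((hasDerivAt_pow 2 s).const_mul ((L : ℝ) / 2)).sub (hd s).hasDerivAt).congr_deriv ?_
    norm_num; ring
  have hdiff : Differentiable ℝ fun s => (L : ℝ) / 2 * s ^ 2 - f s :=
    fun s => (hder s).differentiableAt
  have hdd : deriv (fun s => (L : ℝ) / 2 * s ^ 2 - f s) = fun s => L * s - deriv f s :=
    funext fun s => (hder s).deriv
  have hmono : Monotone (deriv fun s => (L : ℝ) / 2 * s ^ 2 - f s) := by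
    rw [hdd]
    intro s r hsr
    have h1 := hL.dist_le_mul r s
    rw [Real.dist_eq, Real.dist_eq, abs_of_nonneg (sub_nonneg.2 hsr)] at h1
    have h2 := le_abs_self (deriv f r - deriv f s)
    change (L : ℝ) * s - deriv f s ≤ L * r - deriv f r
    linarith
  have := tangent_le_of_convexOn (hmono.convexOn_univ_of_deriv hdiff) hdiff a b
  rw [hdd] at this
  linarith

variable {α : Type*} [MeasurableSpace α] {ν : Measure α}

lemma memLp_comp_of_linear_growth [IsFiniteMeasure ν] {g : ℝ → ℝ} (hg : Measurable g) {A B : ℝ}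
    (hAB : ∀ s, |g s| ≤ A + B * |s|) {v : α → ℝ} (hv : MemLp v 2 ν) :
    MemLp (fun x => g (v x)) 2 ν := by
  refine ((memLp_const A).add (hv.norm.const_mul B)).mono'
    (hg.comp_aemeasurable hv.aestronglyMeasurable.aemeasurable).aestronglyMeasurable ?_
  exact Filter.Eventually.of_forall fun x => hAB (v x)

section

variable {Ψc Ψe : ℝ → ℝ} {L : ℝ≥0} (hΨ : PotentialAssumption Ψc Ψe L)
include hΨ

lemma PotentialAssumption.memLp_deriv_c [IsFiniteMeasure ν] {v : α → ℝ} (hv : MemLp v 2 ν) :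
    MemLp (fun x => deriv Ψc (v x)) 2 ν := by
  refine memLp_comp_of_linear_growth (measurable_deriv _) (A := |deriv Ψc 0|) (B := L)
    (fun s => ?_) hv
  have h := hΨ.lipschitz.dist_le_mul s 0
  rw [Real.dist_eq, Real.dist_eq, sub_zero] at h
  have := abs_sub_abs_le_abs_sub (deriv Ψc s) (deriv Ψc 0)
  linarith

lemma PotentialAssumption.integrable_c [IsFiniteMeasure ν] {v : α → ℝ} (hv : MemLp v 2 ν) :
    Integrable (fun x => Ψc (v x)) ν := by
  have h1 : Integrable (fun x => |Ψc 0| + |deriv Ψc 0| * |v x| + L / 2 * (v x) ^ 2) ν :=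
    ((integrable_const _).add ((hv.integrable (by norm_num)).norm.const_mul _)).add
      (hv.integrable_sq.const_mul _)
  refine h1.mono' (hΨ.diff_c.continuous.comp_aestronglyMeasurable hv.aestronglyMeasurable)
    (Filter.Eventually.of_forall fun x => ?_)
  have hlo := tangent_le_of_convexOn hΨ.convex_c hΨ.diff_c 0 (v x)
  have hup := le_tangent_add_sq hΨ.diff_c hΨ.lipschitz 0 (v x)
  rw [sub_zero] at hlo hup
  have h2 := abs_mul (deriv Ψc 0) (v x)
  have h3 := neg_abs_le (deriv Ψc 0 * v x)
  have h4 := le_abs_self (deriv Ψc 0 * v x)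
  have h5 := neg_abs_le (Ψc 0)
  have h6 := le_abs_self (Ψc 0)
  have h7 : 0 ≤ (L : ℝ) / 2 * v x ^ 2 := by positivity
  rw [Real.norm_eq_abs, abs_le]
  constructor <;> linarith

/-- Since `Ψe ≤ Ψc` grows at most quadratically and `Ψe` is convex, `Ψe'` grows at most linearly.
This makes the explicit term of the scheme well defined on `L²`. -/
lemma PotentialAssumption.linear_growth_deriv_e : ∃ A B : ℝ, ∀ s, |deriv Ψe s| ≤ A + B * |s| := by
  set a := |Ψc 0|
  set b := |deriv Ψc 0|
  set a' := |Ψe 0|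
  set b' := |deriv Ψe 0|
  have ha : 0 ≤ a := abs_nonneg _
  have hb : 0 ≤ b := abs_nonneg _
  have ha' : 0 ≤ a' := abs_nonneg _
  have hb' : 0 ≤ b' := abs_nonneg _
  have hL : (0 : ℝ) ≤ L := L.2
  have hup : ∀ r, Ψe r ≤ a + b * |r| + L / 2 * r ^ 2 := by
    intro r
    have h1 := hΨ.nonneg r
    have h2 := le_tangent_add_sq hΨ.diff_c hΨ.lipschitz 0 r
    rw [sub_zero] at h2
    have h3 := le_abs_self (deriv Ψc 0 * r)
    rw [abs_mul] at h3
    linarith [le_abs_self (Ψc 0)]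
  have hlo : ∀ s, -a' - b' * |s| ≤ Ψe s := by
    intro s
    have h2 := tangent_le_of_convexOn hΨ.convex_e hΨ.diff_e 0 s
    rw [sub_zero] at h2
    have h3 := neg_abs_le (deriv Ψe 0 * s)
    rw [abs_mul] at h3
    linarith [neg_abs_le (Ψe 0)]
  -- Compare `Ψe` at `s` and at distance `1 + |s|` from `s` along the tangent at `s`.
  have key : ∀ s r, |r| = 1 + |s| →
      deriv Ψe s * r ≤ (a + 2 * b + a' + b' + 2 * L * (1 + |s|)) * (1 + |s|) := by
    intro s r hr
    have h1 := tangent_le_of_convexOn hΨ.convex_e hΨ.diff_e s (s + r)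
    rw [add_sub_cancel_left] at h1
    have h2 := hup (s + r)
    have h3 := hlo s
    have hs := abs_nonneg s
    have h4 : |s + r| ≤ 2 * (1 + |s|) := (abs_add_le s r).trans (by linarith)
    have h5 : (s + r) ^ 2 ≤ 4 * (1 + |s|) ^ 2 := by
      rw [← sq_abs (s + r)]
      nlinarith [abs_nonneg (s + r)]
    have h6 : b * |s + r| ≤ b * (2 * (1 + |s|)) := mul_le_mul_of_nonneg_left h4 hb
    have h7 : (L : ℝ) / 2 * (s + r) ^ 2 ≤ L / 2 * (4 * (1 + |s|) ^ 2) :=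
      mul_le_mul_of_nonneg_left h5 (by positivity)
    have h8 : 0 ≤ a * |s| := mul_nonneg ha hs
    have h9 : 0 ≤ a' * |s| := mul_nonneg ha' hs
    nlinarith
  refine ⟨a + 2 * b + a' + b' + 2 * L, 2 * L, fun s => ?_⟩
  have hs : 0 < 1 + |s| := by positivity
  have h1 := key s (1 + |s|) (abs_of_pos hs)
  have h2 := key s (-(1 + |s|)) (by rw [abs_neg, abs_of_pos hs])
  have h3 := le_of_mul_le_mul_right h1 hs
  rw [mul_neg, ← neg_mul] at h2
  have h4 := le_of_mul_le_mul_right h2 hs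
  rw [abs_le]
  constructor <;> linarith

lemma PotentialAssumption.memLp_deriv_e [IsFiniteMeasure ν] {v : α → ℝ} (hv : MemLp v 2 ν) :
    MemLp (fun x => deriv Ψe (v x)) 2 ν := by
  obtain ⟨A, B, hAB⟩ := hΨ.linear_growth_deriv_e
  exact memLp_comp_of_linear_growth (measurable_deriv _) hAB hv

end

variable {d : ℕ} {Ω : Set (Pt d)}

lemma integral_sq_eq_norm_sq {E : Type} [NormedAddCommGroup E] [InnerProductSpace ℝ E]
    (v : L2 Ω E) : ∫ x in Ω, ‖v x‖ ^ 2 = ‖v‖ ^ 2 := by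
  rw [← real_inner_self_eq_norm_sq, L2.inner_def]
  simp

/-- The first-order Taylor remainder of `v ↦ ∫ Ψc(v)` lies between `0` and the quadratic
given by the Lipschitz constant of `Ψc'`. -/
lemma PotentialAssumption.integral_bounds [IsFiniteMeasure (volume.restrict Ω)]
    {Ψc Ψe : ℝ → ℝ} {L : ℝ≥0} (hΨ : PotentialAssumption Ψc Ψe L) (v w : L2 Ω ℝ) (t : ℝ) :
    (∫ x in Ω, Ψc (v x)) + t * (∫ x in Ω, deriv Ψc (v x) * w x) ≤ (∫ x in Ω, Ψc ((v + t • w) x)) ∧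
    (∫ x in Ω, Ψc ((v + t • w) x)) ≤ (∫ x in Ω, Ψc (v x)) + t * (∫ x in Ω, deriv Ψc (v x) * w x)
      + L / 2 * (t ^ 2 * ‖w‖ ^ 2) := by
  have hv := Lp.memLp v
  have hw := Lp.memLp w
  have i1 := hΨ.integrable_c hv
  have i2 := hΨ.integrable_c (Lp.memLp (v + t • w))
  have i3 : Integrable (fun x => t * (deriv Ψc (v x) * w x)) (volume.restrict Ω) :=
    ((hΨ.memLp_deriv_c hv).integrable_mul hw).const_mul t
  have i4 : Integrable (fun x => L / 2 * (t ^ 2 * ‖w x‖ ^ 2)) (volume.restrict Ω) :=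
    (hw.norm.integrable_sq.const_mul _).const_mul _
  have i13 : Integrable (fun x => Ψc (v x) + t * (deriv Ψc (v x) * w x)) (volume.restrict Ω) :=
    i1.add i3
  have hae : ∀ᵐ x ∂(volume.restrict Ω), (v + t • w) x = v x + t * w x := by
    filter_upwards [Lp.coeFn_add v (t • w), Lp.coeFn_smul t w] with x h1 h2
    rw [h1, Pi.add_apply, h2, Pi.smul_apply, smul_eq_mul]
  rw [← integral_const_mul, ← integral_sq_eq_norm_sq w, ← integral_const_mul (t ^ 2),
    ← integral_const_mul (L / 2 : ℝ), ← integral_add i1 i3, ← integral_add i13 i4]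
  constructor
  · refine integral_mono_ae i13 i2 ?_
    filter_upwards [hae] with x hx
    have := tangent_le_of_convexOn hΨ.convex_c hΨ.diff_c (v x) ((v + t • w) x)
    rw [hx] at this ⊢
    linarith
  · refine integral_mono_ae i2 (i13.add i4) ?_
    filter_upwards [hae] with x hx
    have := le_tangent_add_sq hΨ.diff_c hΨ.lipschitz (v x) ((v + t • w) x)
    rw [hx] at this ⊢
    rw [Real.norm_eq_abs, sq_abs]
    linarith

end CHB

/-! ### Square-integrable tensor fields -/

namespace CHB

section Tensor

variable {d : ℕ}

lemma ddot_add_left (A B D : Tensor d) : ddot (A + B) D = ddot A D + ddot B D := by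
  simp [ddot, add_mul, Finset.sum_add_distrib]

lemma ddot_smul_left (t : ℝ) (A D : Tensor d) : ddot (t • A) D = t * ddot A D := by
  simp [ddot, Finset.mul_sum, mul_assoc]

lemma ddot_comm (A B : Tensor d) : ddot A B = ddot B A := by
  simp [ddot, mul_comm]

lemma ddot_self_nonneg (A : Tensor d) : 0 ≤ ddot A A :=
  Finset.sum_nonneg fun _ _ => Finset.sum_nonneg fun _ _ => mul_self_nonneg _

variable {C : Fin d → Fin d → Fin d → Fin d → ℝ} {cC CC : ℝ}

lemma StiffnessAssumption.ddot_stiff_comm (hC : StiffnessAssumption C cC CC) (A B : Tensor d) :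
    ddot A (stiff C B) = ddot B (stiff C A) := by
  have h1 : ddot A (stiff C B) = ∑ q : Fin d × Fin d, ∑ r : Fin d × Fin d,
      A q.1 q.2 * (C q.1 q.2 r.1 r.2 * B r.1 r.2) := by
    simp [ddot, stiff, Fintype.sum_prod_type, Finset.mul_sum]
  have h2 : ddot B (stiff C A) = ∑ q : Fin d × Fin d, ∑ r : Fin d × Fin d,
      B q.1 q.2 * (C q.1 q.2 r.1 r.2 * A r.1 r.2) := by
    simp [ddot, stiff, Fintype.sum_prod_type, Finset.mul_sum]
  rw [h1, h2, Finset.sum_comm]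
  refine Finset.sum_congr rfl fun q _ => Finset.sum_congr rfl fun r _ => ?_
  rw [hC.major r.1 r.2 q.1 q.2]
  ring

lemma StiffnessAssumption.ddot_stiff_add_smul (hC : StiffnessAssumption C cC CC)
    (A B : Tensor d) (t : ℝ) : ddot (A + t • B) (stiff C (A + t • B)) =
      ddot A (stiff C A) + 2 * t * ddot B (stiff C A) + t ^ 2 * ddot B (stiff C B) := by
  rw [ddot_add_left, ddot_smul_left, hC.ddot_stiff_comm A, hC.ddot_stiff_comm B,
    ddot_add_left, ddot_smul_left, ddot_add_left, ddot_smul_left, hC.ddot_stiff_comm A B]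
  ring

lemma StiffnessAssumption.ddot_stiff_nonneg (hC : StiffnessAssumption C cC CC) {A : Tensor d}
    (hA : A.IsSymm) : 0 ≤ ddot A (stiff C A) :=
  (mul_nonneg hC.pos_lower.le (ddot_self_nonneg A)).trans (hC.lower A hA)

variable {α : Type*} [MeasurableSpace α] {ν : Measure α}

/-- The entries of the tensor field `A` are square integrable. -/
def IsL2Field (ν : Measure α) (A : α → Tensor d) : Prop :=
  ∀ i j, MemLp (fun x => A x i j) 2 ν

lemma IsL2Field.add_smul {A B : α → Tensor d} (hA : IsL2Field ν A) (hB : IsL2Field ν B) (t : ℝ) :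
    IsL2Field ν fun x => A x + t • B x :=
  fun i j => (hA i j).add ((hB i j).const_mul t)

lemma IsL2Field.integrable_ddot {A B : α → Tensor d} (hA : IsL2Field ν A) (hB : IsL2Field ν B) :
    Integrable (fun x => ddot (A x) (B x)) ν :=
  integrable_finsetSum _ fun i _ => integrable_finsetSum _ fun j _ =>
    (hA i j).integrable_mul (hB i j)

lemma IsL2Field.stiff {A : α → Tensor d} (hA : IsL2Field ν A)
    (C : Fin d → Fin d → Fin d → Fin d → ℝ) : IsL2Field ν fun x => stiff C (A x) :=
  fun i j => memLp_finsetSum (f := fun k x => ∑ l, C i j k l * A x k l) Finset.univ fun k _ =>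
    memLp_finsetSum Finset.univ fun l _ => (hA k l).const_mul (C i j k l)

/-- The elastic energy product `∫ A : ℂ B` of two tensor fields. -/
def elastic (ν : Measure α) (C : Fin d → Fin d → Fin d → Fin d → ℝ) (A B : α → Tensor d) : ℝ :=
  ∫ x, ddot (A x) (stiff C (B x)) ∂ν

lemma elastic_congr {A A' B B' : α → Tensor d} (hA : A =ᵐ[ν] A') (hB : B =ᵐ[ν] B') :
    elastic ν C A B = elastic ν C A' B' := by
  refine integral_congr_ae ?_
  filter_upwards [hA, hB] with x h1 h2
  rw [h1, h2]

lemma elastic_add_smul_left {A B D : α → Tensor d} (hA : IsL2Field ν A) (hB : IsL2Field ν B)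
    (hD : IsL2Field ν D) (t : ℝ) :
    elastic ν C (fun x => A x + t • B x) D = elastic ν C A D + t * elastic ν C B D := by
  simp only [elastic, ddot_add_left, ddot_smul_left]
  rw [integral_add (hA.integrable_ddot (hD.stiff C))
    ((hB.integrable_ddot (hD.stiff C)).const_mul t), integral_const_mul]

lemma StiffnessAssumption.elastic_add_smul (hC : StiffnessAssumption C cC CC)
    {A B : α → Tensor d} (hA : IsL2Field ν A) (hB : IsL2Field ν B) (t : ℝ) :
    elastic ν C (fun x => A x + t • B x) (fun x => A x + t • B x) =
      elastic ν C A A + 2 * t * elastic ν C B A + t ^ 2 * elastic ν C B B := by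
  have i1 := hA.integrable_ddot (hA.stiff C)
  have i2 := (hB.integrable_ddot (hA.stiff C)).const_mul (2 * t)
  have i3 := (hB.integrable_ddot (hB.stiff C)).const_mul (t ^ 2)
  have i12 : Integrable (fun x => ddot (A x) (CHB.stiff C (A x))
    + 2 * t * ddot (B x) (CHB.stiff C (A x))) ν := i1.add i2
  simp only [elastic, hC.ddot_stiff_add_smul]
  rw [integral_add i12 i3, integral_add i1 i2, integral_const_mul, integral_const_mul]

lemma StiffnessAssumption.elastic_self_nonneg (hC : StiffnessAssumption C cC CC)
    {A : α → Tensor d} (hA : ∀ x, (A x).IsSymm) : 0 ≤ elastic ν C A A :=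
  integral_nonneg fun x => hC.ddot_stiff_nonneg (hA x)

lemma integral_add_smul_sq {a b : α → ℝ} (ha : MemLp a 2 ν) (hb : MemLp b 2 ν) (t : ℝ) :
    ∫ x, (a x + t * b x) ^ 2 ∂ν =
      (∫ x, a x ^ 2 ∂ν) + 2 * t * (∫ x, a x * b x ∂ν) + t ^ 2 * (∫ x, b x ^ 2 ∂ν) := by
  have i1 := ha.integrable_sq
  have i2 : Integrable (fun x => 2 * t * (a x * b x)) ν := (ha.integrable_mul hb).const_mul _
  have i3 := hb.integrable_sq.const_mul (t ^ 2)
  have i12 : Integrable (fun x => a x ^ 2 + 2 * t * (a x * b x)) ν := i1.add i2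
  rw [← integral_const_mul, ← integral_const_mul, ← integral_add i1 i2, ← integral_add i12 i3]
  exact integral_congr_ae (Filter.Eventually.of_forall fun x => by ring)

end Tensor

/-! ### Strains, eigenstrains and the quadratic energy -/

section Fields

variable {d : ℕ} {Ω : Set (Pt d)}

lemma strain_isSymm (u : VecFunGrad Ω) (x : Pt d) : (strain u x).IsSymm := by
  ext i j
  simp [strain, add_comm]

lemma isL2Field_strain (u : VecFunGrad Ω) : IsL2Field (volume.restrict Ω) (strain u) := by
  have h : ∀ i j, MemLp (fun x => (u i).2 x j) 2 (volume.restrict Ω) := fun i j =>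
    (Lp.memLp (u i).2).continuousLinearMap_comp (EuclideanSpace.proj (𝕜 := ℝ) j)
  intro i j
  have := ((h i j).add (h j i)).const_mul (2⁻¹ : ℝ)
  refine this.ae_eq (Filter.Eventually.of_forall fun x => ?_)
  simp [strain, div_eq_inv_mul]

lemma strain_add_smul (u v : VecFunGrad Ω) (t : ℝ) :
    strain (u + t • v) =ᵐ[volume.restrict Ω] fun x => strain u x + t • strain v x := by
  have h : ∀ i, ∀ᵐ x ∂(volume.restrict Ω), ((u + t • v) i).2 x = (u i).2 x + t • (v i).2 x := by
    intro i
    filter_upwards [Lp.coeFn_add (u i).2 (t • (v i).2), Lp.coeFn_smul t (v i).2] with x h1 h2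
    change ((u i).2 + t • (v i).2 : L2 Ω (Pt d)) x = _
    rw [h1, Pi.add_apply, h2, Pi.smul_apply]
  filter_upwards [ae_all_iff.2 h] with x hx
  ext i j
  simp only [strain, Matrix.of_apply, hx, Matrix.add_apply, Matrix.smul_apply, PiLp.add_apply,
    PiLp.smul_apply, smul_eq_mul]
  ring

lemma coeFn_fst_add_smul (φ ψ : FunGrad Ω) (t : ℝ) :
    ∀ᵐ x ∂(volume.restrict Ω), (φ + t • ψ).1 x = φ.1 x + t * ψ.1 x := by
  filter_upwards [Lp.coeFn_add φ.1 (t • ψ.1), Lp.coeFn_smul t ψ.1] with x h1 h2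
  change (φ.1 + t • ψ.1 : L2 Ω ℝ) x = _
  rw [h1, Pi.add_apply, h2, Pi.smul_apply, smul_eq_mul]

lemma coeFn_fst_zero : ∀ᵐ x ∂(volume.restrict Ω), (0 : FunGrad Ω).1 x = 0 :=
  Lp.coeFn_zero ℝ 2 (volume.restrict Ω)

lemma strain_zero : strain (0 : VecFunGrad Ω) =ᵐ[volume.restrict Ω] 0 := by
  have := strain_add_smul (0 : VecFunGrad Ω) 0 (-1)
  rw [smul_zero, add_zero] at this
  filter_upwards [this] with x hx
  simpa using hx

variable {T : ℝ → Tensor d} {cT CT : ℝ}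

lemma EigenstrainAssumption.eq_smul (hT : EigenstrainAssumption Ω T cT CT) (s : ℝ) :
    T s = s • T 1 := by
  rw [← hT.linear.map_smul, smul_eq_mul, mul_one]

lemma EigenstrainAssumption.tensorDeriv_eq (hT : EigenstrainAssumption Ω T cT CT) (s : ℝ) :
    tensorDeriv T s = T 1 := by
  ext i j
  have : (fun r => T r i j) = fun r => r * T 1 i j :=
    funext fun r => by rw [hT.eq_smul r]; rfl
  simp [tensorDeriv, this]

lemma EigenstrainAssumption.isL2Field (hT : EigenstrainAssumption Ω T cT CT) (v : L2 Ω ℝ) :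
    IsL2Field (volume.restrict Ω) fun x => T (v x) := by
  intro i j
  refine ((Lp.memLp v).const_mul (T 1 i j)).ae_eq (Filter.Eventually.of_forall fun x => ?_)
  change _ = T (v x) i j
  rw [hT.eq_smul (v x), Matrix.smul_apply, smul_eq_mul, mul_comm]

variable {C : Fin d → Fin d → Fin d → Fin d → ℝ} {cC CC : ℝ}

lemma elastic_eigenstrain_le (hT : EigenstrainAssumption Ω T cT CT)
    (hC : StiffnessAssumption C cC CC) (v : L2 Ω ℝ) :
    elastic (volume.restrict Ω) C (fun x => T (v x)) (fun x => T (v x)) ≤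
      CC * CT ^ 2 * ‖v‖ ^ 2 := by
  have hL := hT.isL2Field v
  have h0 : 0 ≤ ∫ x in Ω, ddot (T (v x)) (T (v x)) :=
    integral_nonneg fun x => ddot_self_nonneg _
  calc elastic (volume.restrict Ω) C (fun x => T (v x)) (fun x => T (v x))
      ≤ ∫ x in Ω, CC * ddot (T (v x)) (T (v x)) :=
        integral_mono (hL.integrable_ddot (hL.stiff C)) ((hL.integrable_ddot hL).const_mul _)
          fun x => hC.upper _ (hT.symm _)
    _ = CC * √(∫ x in Ω, ddot (T (v x)) (T (v x))) ^ 2 := by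
        rw [integral_const_mul, Real.sq_sqrt h0]
    _ ≤ CC * (CT * ‖v‖) ^ 2 :=
        mul_le_mul_of_nonneg_left (pow_le_pow_left₀ (Real.sqrt_nonneg _) (hT.upper v) 2)
          hC.pos_upper.le
    _ = CC * CT ^ 2 * ‖v‖ ^ 2 := by ring

lemma le_elastic_eigenstrain (hT : EigenstrainAssumption Ω T cT CT)
    (hC : StiffnessAssumption C cC CC) (v : L2 Ω ℝ) :
    cC * cT ^ 2 * ‖v‖ ^ 2 ≤
      elastic (volume.restrict Ω) C (fun x => T (v x)) (fun x => T (v x)) := by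
  have hL := hT.isL2Field v
  have h0 : 0 ≤ ∫ x in Ω, ddot (T (v x)) (T (v x)) :=
    integral_nonneg fun x => ddot_self_nonneg _
  calc cC * cT ^ 2 * ‖v‖ ^ 2 = cC * (cT * ‖v‖) ^ 2 := by ring
    _ ≤ cC * √(∫ x in Ω, ddot (T (v x)) (T (v x))) ^ 2 :=
        mul_le_mul_of_nonneg_left (pow_le_pow_left₀
          (mul_nonneg hT.pos_lower.le (norm_nonneg _)) (hT.lower v) 2) hC.pos_lower.le
    _ = ∫ x in Ω, cC * ddot (T (v x)) (T (v x)) := by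
        rw [integral_const_mul, Real.sq_sqrt h0]
    _ ≤ _ :=
        integral_mono ((hL.integrable_ddot hL).const_mul _) (hL.integrable_ddot (hL.stiff C))
          fun x => hC.lower _ (hT.symm _)

namespace Problem

variable (P : Problem Ω)

/-- The elastic strain `ε(u) - T(φ)`. -/
def misfit (φ : FunGrad Ω) (u : VecFunGrad Ω) (x : Pt d) : Tensor d :=
  strain u x - P.T (φ.1 x)

/-- The pressure variable `θ - α ∇ · u`, up to the factor `M`. -/
def swelling (θ : FunGrad Ω) (u : VecFunGrad Ω) (x : Pt d) : ℝ :=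
  θ.1 x - P.α * dvg u x

lemma memLp_dvg (u : VecFunGrad Ω) : MemLp (dvg u) 2 (volume.restrict Ω) :=
  memLp_finsetSum Finset.univ fun i _ => isL2Field_strain u i i

lemma memLp_swelling (θ : FunGrad Ω) (u : VecFunGrad Ω) :
    MemLp (P.swelling θ u) 2 (volume.restrict Ω) :=
  (Lp.memLp θ.1).sub ((memLp_dvg u).const_mul P.α)

lemma swelling_add_smul (θ θ' : FunGrad Ω) (u u' : VecFunGrad Ω) (t : ℝ) :
    P.swelling (θ + t • θ') (u + t • u') =ᵐ[volume.restrict Ω]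
      fun x => P.swelling θ u x + t * P.swelling θ' u' x := by
  filter_upwards [coeFn_fst_add_smul θ θ' t, strain_add_smul u u' t] with x h1 h2
  rw [swelling, h1, dvg, h2, Matrix.trace_add, Matrix.trace_smul, smul_eq_mul]
  simp only [swelling, dvg]
  ring

lemma swelling_zero : P.swelling 0 0 =ᵐ[volume.restrict Ω] 0 := by
  filter_upwards [strain_zero (Ω := Ω), coeFn_fst_zero (Ω := Ω)] with x h1 h2
  rw [swelling, h2, dvg, h1]
  simp

variable {P}

lemma misfit_eq (φ : FunGrad Ω) (u : VecFunGrad Ω) :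
    P.misfit φ u = fun x => strain u x + (-1 : ℝ) • P.T (φ.1 x) := by
  funext x; simp [misfit, sub_eq_add_neg]

section

variable (hT : EigenstrainAssumption Ω P.T cT CT)
include hT

lemma isL2Field_misfit (φ : FunGrad Ω) (u : VecFunGrad Ω) :
    IsL2Field (volume.restrict Ω) (P.misfit φ u) := by
  rw [misfit_eq]
  exact (isL2Field_strain u).add_smul (hT.isL2Field φ.1) (-1)

lemma misfit_isSymm (φ : FunGrad Ω) (u : VecFunGrad Ω) (x : Pt d) : (P.misfit φ u x).IsSymm :=
  (strain_isSymm u x).sub (hT.symm _)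

lemma misfit_add_smul (φ φ' : FunGrad Ω) (u u' : VecFunGrad Ω) (t : ℝ) :
    P.misfit (φ + t • φ') (u + t • u') =ᵐ[volume.restrict Ω]
      fun x => P.misfit φ u x + t • P.misfit φ' u' x := by
  filter_upwards [coeFn_fst_add_smul φ φ' t, strain_add_smul u u' t] with x h1 h2
  rw [misfit, h1, h2, hT.eq_smul, add_smul, mul_smul, ← hT.eq_smul, ← hT.eq_smul]
  simp only [misfit, smul_sub]
  abel

lemma Equad_eq (φ : FunGrad Ω) (u : VecFunGrad Ω) (θ : FunGrad Ω) :
    P.Equad φ u θ = P.γ * P.ℓ / 2 * ‖φ.2‖ ^ 2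
      + 1 / 2 * elastic (volume.restrict Ω) P.C (P.misfit φ u) (P.misfit φ u)
      + P.M / 2 * ∫ x in Ω, P.swelling θ u x ^ 2 := by
  have i1 : Integrable (fun x => P.γ * P.ℓ / 2 * ‖φ.2 x‖ ^ 2) (volume.restrict Ω) :=
    (Lp.memLp φ.2).norm.integrable_sq.const_mul _
  have hm := isL2Field_misfit hT φ u
  have i2 := (hm.integrable_ddot (hm.stiff P.C)).const_mul (1 / 2 : ℝ)
  have i3 := (P.memLp_swelling θ u).integrable_sq.const_mul (P.M / 2)
  have i12 : Integrable (fun x => P.γ * P.ℓ / 2 * ‖φ.2 x‖ ^ 2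
    + 1 / 2 * ddot (P.misfit φ u x) (stiff P.C (P.misfit φ u x))) (volume.restrict Ω) := i1.add i2
  rw [← integral_sq_eq_norm_sq, elastic, ← integral_const_mul, ← integral_const_mul,
    ← integral_const_mul, ← integral_add i1 i2, ← integral_add i12 i3]
  rfl

lemma elastic_misfit_left (φ' : FunGrad Ω) (u' : VecFunGrad Ω) (φ : FunGrad Ω)
    (u : VecFunGrad Ω) :
    elastic (volume.restrict Ω) P.C (P.misfit φ' u') (P.misfit φ u) =
      (∫ x in Ω, ddot (P.stress φ u x) (strain u' x))
      - ∫ x in Ω, ddot (tensorDeriv P.T (φ.1 x)) (P.stress φ u x) * φ'.1 x := by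
  rw [misfit_eq φ' u', elastic_add_smul_left (isL2Field_strain u') (hT.isL2Field φ'.1)
    (isL2Field_misfit hT φ u), neg_one_mul, ← sub_eq_add_neg]
  congr 1
  · exact integral_congr_ae (Filter.Eventually.of_forall fun x => ddot_comm _ _)
  · refine integral_congr_ae (Filter.Eventually.of_forall fun x => ?_)
    change ddot (P.T (φ'.1 x)) (P.stress φ u x) = _ * _
    rw [hT.tensorDeriv_eq, hT.eq_smul, ddot_smul_left, mul_comm]

lemma Equad_biot (u : VecFunGrad Ω) (θ : FunGrad Ω) :
    P.Equad 0 u θ = 1 / 2 * elastic (volume.restrict Ω) P.C (strain u) (strain u)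
      + P.M / 2 * ∫ x in Ω, P.swelling θ u x ^ 2 := by
  have h1 : P.misfit 0 u =ᵐ[volume.restrict Ω] strain u := by
    filter_upwards [coeFn_fst_zero (Ω := Ω)] with x hx
    rw [misfit, hx, hT.linear.map_zero, sub_zero]
  rw [Equad_eq hT, elastic_congr h1 h1]
  simp

variable (hC : StiffnessAssumption P.C cC CC)
include hC

lemma Equad_add_smul (φ φ' : FunGrad Ω) (u u' : VecFunGrad Ω) (θ θ' : FunGrad Ω) (t : ℝ) :
    P.Equad (φ + t • φ') (u + t • u') (θ + t • θ') = P.Equad φ u θ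
      + t * (P.γ * P.ℓ * inner ℝ φ.2 φ'.2
        + elastic (volume.restrict Ω) P.C (P.misfit φ' u') (P.misfit φ u)
        + P.M * ∫ x in Ω, P.swelling θ u x * P.swelling θ' u' x)
      + t ^ 2 * P.Equad φ' u' θ' := by
  have h1 := hC.elastic_add_smul (isL2Field_misfit hT φ u) (isL2Field_misfit hT φ' u') t
  rw [← elastic_congr (misfit_add_smul hT φ φ' u u' t) (misfit_add_smul hT φ φ' u u' t)] at h1
  have h2 := integral_add_smul_sq (P.memLp_swelling θ u) (P.memLp_swelling θ' u') t
  have h3 : ∫ x in Ω, P.swelling (θ + t • θ') (u + t • u') x ^ 2 =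
      ∫ x in Ω, (P.swelling θ u x + t * P.swelling θ' u' x) ^ 2 := by
    refine integral_congr_ae ?_
    filter_upwards [P.swelling_add_smul θ θ' u u' t] with x hx
    rw [hx]
  have h4 : ‖(φ + t • φ').2‖ ^ 2 = ‖φ.2‖ ^ 2 + 2 * t * inner ℝ φ.2 φ'.2 + t ^ 2 * ‖φ'.2‖ ^ 2 := by
    rw [Prod.snd_add, Prod.smul_snd, norm_add_sq_real, real_inner_smul_right, norm_smul, mul_pow,
      Real.norm_eq_abs, sq_abs]
    ring
  rw [Equad_eq hT, Equad_eq hT φ, Equad_eq hT φ', h1, h3, h2, h4]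
  ring

/-- The quadratic energy of an increment controls the gradient of its phase field. -/
lemma le_Equad (hM : 0 < P.M) (φ : FunGrad Ω) (u : VecFunGrad Ω) (θ : FunGrad Ω) :
    P.γ * P.ℓ / 2 * ‖φ.2‖ ^ 2 ≤ P.Equad φ u θ := by
  rw [Equad_eq hT]
  have h1 : 0 ≤ elastic (volume.restrict Ω) P.C (P.misfit φ u) (P.misfit φ u) :=
    hC.elastic_self_nonneg (misfit_isSymm hT φ u)
  have h2 : 0 ≤ P.M / 2 * ∫ x in Ω, P.swelling θ u x ^ 2 :=
    mul_nonneg (by positivity) (integral_nonneg fun x => sq_nonneg _)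
  linarith

lemma Equad_phase (φ : FunGrad Ω) :
    P.Equad φ 0 0 = P.γ * P.ℓ / 2 * ‖φ.2‖ ^ 2
      + 1 / 2 * elastic (volume.restrict Ω) P.C (fun x => P.T (φ.1 x))
        (fun x => P.T (φ.1 x)) := by
  have h2 : ∫ x in Ω, P.swelling 0 0 x ^ 2 = 0 := by
    refine integral_eq_zero_of_ae ?_
    filter_upwards [P.swelling_zero] with x hx
    simp [hx]
  have h3 := hC.elastic_add_smul (isL2Field_strain (0 : VecFunGrad Ω)) (hT.isL2Field φ.1) (-1)
  have h4 : ∀ B : Pt d → Tensor d,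
      elastic (volume.restrict Ω) P.C B (strain (0 : VecFunGrad Ω)) = 0 := by
    intro B
    rw [elastic_congr Filter.EventuallyEq.rfl strain_zero]
    simp [elastic, ddot, stiff]
  rw [← misfit_eq, h4, h4] at h3
  rw [Equad_eq hT, h2, h3]
  ring

/-- Completing the square in the elastic energy: a multiple `K` of the eigenstrain energy pays for
the coupling and leaves the fraction `K / (K + 1)` of the Biot energy. -/
lemma Equad_biot_le (hM : 0 < P.M) {K : ℝ} (hK : 0 < K) (φ : FunGrad Ω) (u : VecFunGrad Ω)
    (θ : FunGrad Ω) :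
    P.γ * P.ℓ / 2 * ‖φ.2‖ ^ 2 + K / (K + 1) * P.Equad 0 u θ ≤ P.Equad φ u θ
      + K / 2 * elastic (volume.restrict Ω) P.C (fun x => P.T (φ.1 x))
        (fun x => P.T (φ.1 x)) := by
  have h1 := hC.elastic_add_smul (isL2Field_strain u) (hT.isL2Field φ.1) (-1)
  have h2 := hC.elastic_add_smul (isL2Field_strain u) (hT.isL2Field φ.1) (-(K + 1))
  have h3 : 0 ≤ elastic (volume.restrict Ω) P.C (fun x => strain u x + (-(K + 1)) • P.T (φ.1 x))
      (fun x => strain u x + (-(K + 1)) • P.T (φ.1 x)) :=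
    hC.elastic_self_nonneg fun x => (strain_isSymm u x).add ((hT.symm _).smul _)
  have h4 : 0 ≤ ∫ x in Ω, P.swelling θ u x ^ 2 := integral_nonneg fun x => sq_nonneg _
  rw [← misfit_eq] at h1
  rw [h2] at h3
  rw [Equad_eq hT φ, Equad_biot hT, h1]
  set X := elastic (volume.restrict Ω) P.C (strain u) (strain u)
  set Y := elastic (volume.restrict Ω) P.C (fun x => P.T (φ.1 x)) (fun x => P.T (φ.1 x))
  set Z := elastic (volume.restrict Ω) P.C (fun x => P.T (φ.1 x)) (strain u)
  set S := ∫ x in Ω, P.swelling θ u x ^ 2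
  have h5 : 0 ≤ P.M * S + (X + 2 * (-(K + 1)) * Z + (-(K + 1)) ^ 2 * Y) :=
    add_nonneg (mul_nonneg hM.le h4) h3
  have h6 : 0 ≤ (P.M * S + (X + 2 * (-(K + 1)) * Z + (-(K + 1)) ^ 2 * Y)) / (2 * (K + 1)) :=
    div_nonneg h5 (by positivity)
  have h7 : (P.M * S + (X + 2 * (-(K + 1)) * Z + (-(K + 1)) ^ 2 * Y)) / (2 * (K + 1)) =
      1 / 2 * (X + 2 * -1 * Z + (-1) ^ 2 * Y) + P.M / 2 * S + K / 2 * Y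
        - K / (K + 1) * (1 / 2 * X + P.M / 2 * S) := by
    field_simp
    ring
  linarith

end

end Problem

end Fields

end CHB

/-! ### Mass balance -/

namespace CHB

variable {d : ℕ} {Ω : Set (Pt d)} [IsFiniteMeasure (volume.restrict Ω)]

lemma integral_sub_div_eq (φ ψ : FunGrad Ω) (τ : ℝ) :
    ∫ x in Ω, (φ.1 x - ψ.1 x) / τ = (total Ω φ - total Ω ψ) / τ := by
  rw [integral_div, integral_sub (L2.integrable φ.1) (L2.integrable ψ.1)]
  rfl

lemma sub_mem_meanFree {V : Submodule ℝ (FunGrad Ω)} {φ φ' ψ : FunGrad Ω} {τ r : ℝ} (hτ : τ ≠ 0)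
    (hφ : φ ∈ V ∧ ∫ x in Ω, (φ.1 x - ψ.1 x) / τ = r)
    (hφ' : φ' ∈ V ∧ ∫ x in Ω, (φ'.1 x - ψ.1 x) / τ = r) : φ - φ' ∈ meanFree V := by
  refine mem_meanFreeSubmodule.1 ⟨sub_mem hφ.1 hφ'.1, ?_⟩
  have h := hφ.2.trans hφ'.2.symm
  rw [integral_sub_div_eq, integral_sub_div_eq, div_left_inj' hτ] at h
  rw [SetLike.mem_coe, LinearMap.mem_ker, map_sub]
  linarith

/-- Testing a discrete mass balance with the constant function. -/
lemma integral_sub_div_eq_of_balance {V : Submodule ℝ (FunGrad Ω)} (hV : ContainsConstants V)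
    {φ ψ ν : FunGrad Ω} {τ y : ℝ} {s : L2 Ω ℝ} (hτ : τ ≠ 0)
    (hbal : ∀ η ∈ V, inner ℝ (φ.1 - ψ.1) η.1 + τ * (y * inner ℝ ν.2 η.2) - τ * inner ℝ s η.1 = 0) :
    ∫ x in Ω, (φ.1 x - ψ.1 x) / τ = ∫ x in Ω, s x := by
  obtain ⟨e, heV, he, he2⟩ := hV
  have h := hbal e heV
  rw [he2, inner_zero_right, inner_sub_left, ContainsConstants.inner_eq he,
    ContainsConstants.inner_eq he, ContainsConstants.inner_eq he] at h
  rw [integral_sub_div_eq, div_eq_iff hτ]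
  change (∫ x in Ω, φ.1 x) - (∫ x in Ω, ψ.1 x) = _
  linarith

/-! ### Expansion of the potential -/

namespace Problem

variable (P : Problem Ω)

/-- The derivative of `H` in the direction `η` of the phase field, at a state with displacement
`u` and phase field `φ`; `g` is the potential of `φ - φprev - τ R`. -/
def chDeriv (φ : FunGrad Ω) (u : VecFunGrad Ω) (g η : FunGrad Ω) : ℝ :=
  1 / P.τ * inner ℝ η.1 g.1 + P.γ * P.ℓ * inner ℝ φ.2 η.2
    - (∫ x in Ω, ddot (tensorDeriv P.T (φ.1 x)) (P.stress φ u x) * η.1 x)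
    + P.γ / P.ℓ * (∫ x in Ω, (deriv P.Ψc (φ.1 x) - deriv P.Ψe (P.φprev.1 x)) * η.1 x)

/-- The derivative of `H` in the direction `(v, η)` of displacement and fluid content;
`g` is the potential of `θ - θprev - τ S`. -/
def biotDeriv (φ : FunGrad Ω) (u : VecFunGrad Ω) (θ g : FunGrad Ω) (v : VecFunGrad Ω)
    (η : FunGrad Ω) : ℝ :=
  1 / P.τ * inner ℝ η.1 g.1 + (∫ x in Ω, ddot (P.stress φ u x) (strain v x))
    + P.M * (∫ x in Ω, P.swelling θ u x * P.swelling η v x) - ∑ i, inner ℝ (P.f i) (v i).1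

omit [IsFiniteMeasure (volume.restrict Ω)] in
lemma chDeriv_zero (φ : FunGrad Ω) (u : VecFunGrad Ω) (g : FunGrad Ω) :
    P.chDeriv φ u g 0 = 0 := by
  have h1 : ∀ a : Pt d → ℝ, ∫ x in Ω, a x * (0 : FunGrad Ω).1 x = 0 := fun a => by
    refine integral_eq_zero_of_ae ?_
    filter_upwards [coeFn_fst_zero (Ω := Ω)] with x hx
    simp only [hx, mul_zero, Pi.zero_apply]
  rw [chDeriv, h1, h1, Prod.fst_zero, Prod.snd_zero, inner_zero_left, inner_zero_right]
  ring

omit [IsFiniteMeasure (volume.restrict Ω)] in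
lemma biotDeriv_zero (φ : FunGrad Ω) (u : VecFunGrad Ω) (θ g : FunGrad Ω) :
    P.biotDeriv φ u θ g 0 0 = 0 := by
  have h1 : ∫ x in Ω, ddot (P.stress φ u x) (strain (0 : VecFunGrad Ω) x) = 0 := by
    refine integral_eq_zero_of_ae ?_
    filter_upwards [strain_zero (Ω := Ω)] with x hx
    simp [hx, ddot]
  have h2 : ∫ x in Ω, P.swelling θ u x * P.swelling 0 0 x = 0 := by
    refine integral_eq_zero_of_ae ?_
    filter_upwards [P.swelling_zero] with x hx
    simp [hx]
  rw [biotDeriv, h1, h2]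
  simp

/-- The quadratic part of `H`, evaluated at an increment. -/
def quadEnergy (φ : FunGrad Ω) (u : VecFunGrad Ω) (θ : FunGrad Ω) : ℝ :=
  dualNorm P.Vch P.m φ.1 ^ 2 / (2 * P.τ) + P.Equad φ u θ
    + dualNorm P.Vf P.κ θ.1 ^ 2 / (2 * P.τ)

variable {P}

/-- Second-order expansion of `H` along a line: only the convex potential `Ψc` is not quadratic,
and its Taylor remainder is two-sidedly bounded. -/
lemma H_add_smul (hpos : P.PositiveParameters) {L : ℝ≥0}
    (hΨ : PotentialAssumption P.Ψc P.Ψe L) {cC CC cT CT : ℝ}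
    (hC : StiffnessAssumption P.C cC CC) (hT : EigenstrainAssumption Ω P.T cT CT)
    {φ θ gφ gθ δφ δθ kφ kθ : FunGrad Ω} (u v : VecFunGrad Ω)
    (hgφ : IsPotentialOf P.Vch P.m (φ.1 - P.φprev.1 - P.τ • P.R) gφ)
    (hgθ : IsPotentialOf P.Vf P.κ (θ.1 - P.θprev.1 - P.τ • P.S) gθ)
    (hkφ : IsPotentialOf P.Vch P.m δφ.1 kφ) (hkθ : IsPotentialOf P.Vf P.κ δθ.1 kθ) (t : ℝ) :
    P.H φ u θ + t * (P.chDeriv φ u gφ δφ + P.biotDeriv φ u θ gθ v δθ)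
        + t ^ 2 * P.quadEnergy δφ v δθ ≤ P.H (φ + t • δφ) (u + t • v) (θ + t • δθ) ∧
    P.H (φ + t • δφ) (u + t • v) (θ + t • δθ) ≤
      P.H φ u θ + t * (P.chDeriv φ u gφ δφ + P.biotDeriv φ u θ gθ v δθ)
        + t ^ 2 * (P.quadEnergy δφ v δθ + P.γ / P.ℓ * (L / 2 * ‖δφ.1‖ ^ 2)) := by
  have hτ := hpos.τ
  have hγℓ : 0 < P.γ / P.ℓ := div_pos hpos.γ hpos.ℓ
  have e1 : (φ + t • δφ).1 - P.φprev.1 - P.τ • P.R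
      = (φ.1 - P.φprev.1 - P.τ • P.R) + t • δφ.1 := by
    rw [Prod.fst_add, Prod.smul_fst]; abel
  have e2 : (θ + t • δθ).1 - P.θprev.1 - P.τ • P.S
      = (θ.1 - P.θprev.1 - P.τ • P.S) + t • δθ.1 := by
    rw [Prod.fst_add, Prod.smul_fst]; abel
  have h1 := hgφ.dualNorm_sq_add_smul hpos.m hkφ t
  have h2 := hgθ.dualNorm_sq_add_smul hpos.κ hkθ t
  have h3 := Equad_add_smul hT hC φ δφ u v θ δθ t
  rw [elastic_misfit_left hT] at h3
  have i1 : Integrable (fun x => deriv P.Ψe (P.φprev.1 x) * φ.1 x) (volume.restrict Ω) :=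
    (hΨ.memLp_deriv_e (Lp.memLp _)).integrable_mul (Lp.memLp _)
  have i2 : Integrable (fun x => deriv P.Ψe (P.φprev.1 x) * δφ.1 x) (volume.restrict Ω) :=
    (hΨ.memLp_deriv_e (Lp.memLp _)).integrable_mul (Lp.memLp _)
  have i3 : Integrable (fun x => deriv P.Ψc (φ.1 x) * δφ.1 x) (volume.restrict Ω) :=
    (hΨ.memLp_deriv_c (Lp.memLp _)).integrable_mul (Lp.memLp _)
  have h4 : ∫ x in Ω, deriv P.Ψe (P.φprev.1 x) * (φ + t • δφ).1 x =
      (∫ x in Ω, deriv P.Ψe (P.φprev.1 x) * φ.1 x)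
        + t * ∫ x in Ω, deriv P.Ψe (P.φprev.1 x) * δφ.1 x := by
    rw [← integral_const_mul, ← integral_add i1 (i2.const_mul t)]
    refine integral_congr_ae ?_
    filter_upwards [coeFn_fst_add_smul φ δφ t] with x hx
    rw [hx]; ring
  have h5 : ∫ x in Ω, (deriv P.Ψc (φ.1 x) - deriv P.Ψe (P.φprev.1 x)) * δφ.1 x =
      (∫ x in Ω, deriv P.Ψc (φ.1 x) * δφ.1 x)
        - ∫ x in Ω, deriv P.Ψe (P.φprev.1 x) * δφ.1 x := by
    rw [← integral_sub i3 i2]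
    exact integral_congr_ae (Filter.Eventually.of_forall fun x => sub_mul _ _ _)
  have h6 : ∑ i, inner ℝ (P.f i) ((u + t • v) i).1 =
      ∑ i, inner ℝ (P.f i) (u i).1 + t * ∑ i, inner ℝ (P.f i) (v i).1 := by
    rw [Finset.mul_sum, ← Finset.sum_add_distrib]
    refine Finset.sum_congr rfl fun i _ => ?_
    rw [Pi.add_apply, Pi.smul_apply, Prod.fst_add, Prod.smul_fst, inner_add_right,
      real_inner_smul_right]
  obtain ⟨h7, h8⟩ := hΨ.integral_bounds φ.1 δφ.1 t
  have h7' := mul_le_mul_of_nonneg_left h7 hγℓ.le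
  have h8' := mul_le_mul_of_nonneg_left h8 hγℓ.le
  have e3 : (φ + t • δφ).1 = φ.1 + t • δφ.1 := rfl
  have hH : P.H (φ + t • δφ) (u + t • v) (θ + t • δθ) =
      P.H φ u θ + t * (P.chDeriv φ u gφ δφ + P.biotDeriv φ u θ gθ v δθ)
        + t ^ 2 * P.quadEnergy δφ v δθ
        + P.γ / P.ℓ * ((∫ x in Ω, P.Ψc ((φ.1 + t • δφ.1) x)) - (∫ x in Ω, P.Ψc (φ.1 x))
          - t * ∫ x in Ω, deriv P.Ψc (φ.1 x) * δφ.1 x) := by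
    rw [H, H, Ec, Ec, e1, e2, h1, h2, h3, h4, h6, chDeriv, biotDeriv, quadEnergy, h5, ← e3]
    field_simp
    ring
  rw [hH]
  constructor <;> linarith

/-! ### Optimality of the two substeps -/

variable (hpos : P.PositiveParameters) (hconf : P.Conforming)
include hpos hconf

lemma IsChStep.mem_VchBar {φ μ : FunGrad Ω} {u : VecFunGrad Ω} (h : P.IsChStep u φ μ) :
    φ ∈ P.VchBar :=
  ⟨h.φ_mem, integral_sub_div_eq_of_balance hconf.const_ch hpos.τ.ne' h.balance⟩

lemma IsBiotStep.mem_VfBar {φ θ p : FunGrad Ω} {u : VecFunGrad Ω} (h : P.IsBiotStep φ u θ p) :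
    θ ∈ P.VfBar :=
  ⟨h.θ_mem, integral_sub_div_eq_of_balance hconf.const_f hpos.τ.ne' h.flow⟩

variable (hΩ : (volume.restrict Ω).real univ ≠ 0)
include hΩ

/-- The Cahn-Hilliard step is the Euler-Lagrange equation of `H` in the phase field, with the
chemical potential in the role of the potential of the mass defect. -/
lemma IsChStep.exists_chDeriv_eq_zero {φ μ : FunGrad Ω} {u : VecFunGrad Ω}
    (h : P.IsChStep u φ μ) :
    ∃ g, IsPotentialOf P.Vch P.m (φ.1 - P.φprev.1 - P.τ • P.R) g ∧
      ∀ η ∈ meanFree P.Vch, P.chDeriv φ u g η = 0 := by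
  obtain ⟨g, hg, hg'⟩ := exists_isPotentialOf_of_balance hΩ hconf.const_ch (y := P.m) (τ := P.τ)
    (s := φ.1 - P.φprev.1 - P.τ • P.R) h.μ_mem fun η hη => by
      rw [inner_sub_left, real_inner_smul_left]
      linarith [h.balance η hη]
  refine ⟨g, hg, fun η hη => ?_⟩
  have hτ := hpos.τ.ne'
  have h1 : 1 / P.τ * inner ℝ η.1 g.1 = -inner ℝ μ.1 η.1 := by
    rw [hg' η hη]; field_simp
  rw [chDeriv, h1]
  linear_combination -(h.chemical η hη.1)

/-- The Biot step is the Euler-Lagrange equation of `H` in displacement and fluid content, with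
the pressure in the role of the potential of the mass defect. -/
lemma IsBiotStep.exists_biotDeriv_eq_zero {φ θ p : FunGrad Ω} {u : VecFunGrad Ω}
    (h : P.IsBiotStep φ u θ p) :
    ∃ g, IsPotentialOf P.Vf P.κ (θ.1 - P.θprev.1 - P.τ • P.S) g ∧
      ∀ v ∈ P.Vu, ∀ η ∈ meanFree P.Vf, P.biotDeriv φ u θ g v η = 0 := by
  obtain ⟨g, hg, hg'⟩ := exists_isPotentialOf_of_balance hΩ hconf.const_f (y := P.κ) (τ := P.τ)
    (s := θ.1 - P.θprev.1 - P.τ • P.S) h.p_mem fun η hη => by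
      rw [inner_sub_left, real_inner_smul_left]
      linarith [h.flow η hη]
  refine ⟨g, hg, fun v hv η hη => ?_⟩
  have hτ := hpos.τ.ne'
  have h1 : 1 / P.τ * inner ℝ η.1 g.1 = -inner ℝ p.1 η.1 := by
    rw [hg' η hη]; field_simp
  have hs := P.memLp_swelling θ u
  have h2 : ∫ x in Ω, P.swelling θ u x * P.swelling η v x =
      (∫ x in Ω, P.swelling θ u x * η.1 x) - P.α * ∫ x in Ω, P.swelling θ u x * dvg v x := by
    have i1 : Integrable (fun x => P.swelling θ u x * η.1 x) (volume.restrict Ω) :=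
      hs.integrable_mul (Lp.memLp η.1)
    have i2 : Integrable (fun x => P.swelling θ u x * dvg v x) (volume.restrict Ω) :=
      hs.integrable_mul (memLp_dvg v)
    rw [← integral_const_mul, ← integral_sub i1 (i2.const_mul P.α)]
    exact integral_congr_ae (Filter.Eventually.of_forall fun x => by
      simp only [swelling]; ring)
  have h3 := h.elasticity v hv
  have h4 := h.pressure η hη.1
  have h5 : ∫ x in Ω, P.α * P.M * (θ.1 x - P.α * dvg u x) * dvg v x =
      P.α * P.M * ∫ x in Ω, P.swelling θ u x * dvg v x := by
    rw [← integral_const_mul]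
    exact integral_congr_ae (Filter.Eventually.of_forall fun x => mul_assoc _ _ _)
  have h6 : ∫ x in Ω, P.M * (θ.1 x - P.α * dvg u x) * η.1 x =
      P.M * ∫ x in Ω, P.swelling θ u x * η.1 x := by
    rw [← integral_const_mul]
    exact integral_congr_ae (Filter.Eventually.of_forall fun x => mul_assoc _ _ _)
  rw [h5] at h3
  rw [h6] at h4
  rw [biotDeriv, h1, h2]
  linear_combination h3 - h4

end Problem

end CHB

/-! ### Coercivity and contraction -/

namespace CHB

/-- The contraction mechanism of one exact block minimization. If `a` is the derivative of the
energy towards a competitor, `N` the block energy of the increment, `b` the coercivity constant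
and `l` the smoothness constant, then the best step along the increment has length `b / l`. -/
lemma sub_le_of_block_step {old new opt a N b l : ℝ} (hb : 0 ≤ b) (hl : 0 < l)
    (hlow : old + a + b * N ≤ opt) (hup : new ≤ old + b / l * a + (b / l) ^ 2 * (l * N)) :
    new - opt ≤ (1 - b / l) * (old - opt) := by
  have h1 := mul_le_mul_of_nonneg_left hlow (div_nonneg hb hl.le)
  have h2 : (b / l) ^ 2 * (l * N) = b / l * (b * N) := by field_simp
  rw [h2] at hup
  linarith

namespace Problem

variable {d : ℕ} {Ω : Set (Pt d)} {P : Problem Ω}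
  {cC CC cT CT CΩ h Cinv : ℝ}

/-- The inverse and Poincaré inequalities bound the diffusive energy of a mean-free discrete
phase field from below in `L²`. -/
lemma le_diffusive_energy (hpos : P.PositiveParameters) (hconf : P.Conforming)
    (hCΩ : IsPoincareConstant Ω CΩ) (hh : 0 < h) (hCinv : IsInverseConstant P.Vch P.m h Cinv)
    {φ k : FunGrad Ω} (hφ : φ ∈ meanFree P.Vch) (hk : IsPotentialOf P.Vch P.m φ.1 k) :
    (1 / P.τ * (h ^ 2 / Cinv ^ 2) + P.γ * P.ℓ * (1 / CΩ ^ 2)) / 2 * ‖φ.1‖ ^ 2 ≤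
      dualNorm P.Vch P.m φ.1 ^ 2 / (2 * P.τ) + P.γ * P.ℓ / 2 * ‖φ.2‖ ^ 2 := by
  have hτ := hpos.τ
  have hγℓ : 0 < P.γ * P.ℓ := mul_pos hpos.γ hpos.ℓ
  have h1 := hk.le_dualNorm_sq hpos.m hh hCinv hφ
  have h2 : 1 / CΩ ^ 2 * ‖φ.1‖ ^ 2 ≤ ‖φ.2‖ ^ 2 := by
    have h3 := pow_le_pow_left₀ (norm_nonneg _) (hCΩ.2 φ (hconf.sub_ch φ hφ.1) hφ.2) 2
    have h4 : 0 < CΩ ^ 2 := pow_pos hCΩ.1 2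
    rw [one_div, inv_mul_le_iff₀ h4]
    linarith
  have h3 := mul_le_mul_of_nonneg_left h1 (show 0 ≤ 1 / (2 * P.τ) by positivity)
  have h4 := mul_le_mul_of_nonneg_left h2 (show 0 ≤ P.γ * P.ℓ / 2 by positivity)
  calc _ = 1 / (2 * P.τ) * (h ^ 2 / Cinv ^ 2 * ‖φ.1‖ ^ 2)
        + P.γ * P.ℓ / 2 * (1 / CΩ ^ 2 * ‖φ.1‖ ^ 2) := by field_simp
    _ ≤ 1 / (2 * P.τ) * dualNorm P.Vch P.m φ.1 ^ 2 + P.γ * P.ℓ / 2 * ‖φ.2‖ ^ 2 := add_le_add h3 h4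
    _ = _ := by ring

/-- The ratio `K` with `β = K / (K + 1)`: the diffusive energy of a phase field is at least `K`
times its eigenstrain energy. -/
def couplingRatio (P : Problem Ω) (h Cinv CΩ CC CT : ℝ) : ℝ :=
  h ^ 2 / (P.τ * Cinv ^ 2 * CC * CT ^ 2) + P.γ * P.ℓ / (CΩ ^ 2 * CC * CT ^ 2)

lemma couplingRatio_pos (hpos : P.PositiveParameters) (hC : StiffnessAssumption P.C cC CC)
    (hT : EigenstrainAssumption Ω P.T cT CT) (hCΩ : IsPoincareConstant Ω CΩ) (hh : 0 < h)
    (hCinv : IsInverseConstant P.Vch P.m h Cinv) : 0 < P.couplingRatio h Cinv CΩ CC CT := by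
  have := hpos.τ
  have := hpos.γ
  have := hpos.ℓ
  have := hC.pos_upper
  have := hT.pos_upper
  have := hCΩ.1
  have := hCinv.1
  rw [couplingRatio]
  positivity

lemma beta_eq (hK : 0 < P.couplingRatio h Cinv CΩ CC CT) :
    P.beta h Cinv CΩ CC CT =
      P.couplingRatio h Cinv CΩ CC CT / (P.couplingRatio h Cinv CΩ CC CT + 1) := by
  change 1 - (P.couplingRatio h Cinv CΩ CC CT + 1)⁻¹ = _
  field_simp
  ring

lemma quadEnergy_nonneg (hpos : P.PositiveParameters) (hC : StiffnessAssumption P.C cC CC)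
    (hT : EigenstrainAssumption Ω P.T cT CT) (φ : FunGrad Ω) (u : VecFunGrad Ω) (θ : FunGrad Ω) :
    0 ≤ P.quadEnergy φ u θ := by
  have := hpos.τ
  have := hpos.γ
  have := hpos.ℓ
  have h1 : 0 ≤ P.Equad φ u θ := le_trans (by positivity) (le_Equad hT hC hpos.M φ u θ)
  rw [quadEnergy]
  positivity

section

variable [IsFiniteMeasure (volume.restrict Ω)] (hpos : P.PositiveParameters) (hconf : P.Conforming)
  (hC : StiffnessAssumption P.C cC CC) (hT : EigenstrainAssumption Ω P.T cT CT)
  (hCΩ : IsPoincareConstant Ω CΩ) (hh : 0 < h) (hCinv : IsInverseConstant P.Vch P.m h Cinv)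
  {φ k : FunGrad Ω} (hφ : φ ∈ meanFree P.Vch) (hk : IsPotentialOf P.Vch P.m φ.1 k)
include hpos hconf hC hT hCΩ hh hCinv hφ hk

omit [IsFiniteMeasure (volume.restrict Ω)] in
lemma couplingRatio_mul_elastic_le :
    P.couplingRatio h Cinv CΩ CC CT / 2 * elastic (volume.restrict Ω) P.C
        (fun x => P.T (φ.1 x)) (fun x => P.T (φ.1 x)) ≤
      dualNorm P.Vch P.m φ.1 ^ 2 / (2 * P.τ) + P.γ * P.ℓ / 2 * ‖φ.2‖ ^ 2 := by
  have hK := couplingRatio_pos hpos hC hT hCΩ hh hCinv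
  refine le_trans ?_ (le_diffusive_energy hpos hconf hCΩ hh hCinv hφ hk)
  have := hpos.τ
  have := hC.pos_upper
  have := hT.pos_upper
  have := hCΩ.1
  have := hCinv.1
  calc _ ≤ P.couplingRatio h Cinv CΩ CC CT / 2 * (CC * CT ^ 2 * ‖φ.1‖ ^ 2) :=
        mul_le_mul_of_nonneg_left (elastic_eigenstrain_le hT hC φ.1) (by positivity)
    _ = _ := by rw [couplingRatio]; field_simp

/-- Relative coercivity of the joint energy with respect to the phase-field energy. -/
lemma beta_mul_phase_le (u : VecFunGrad Ω) (θ : FunGrad Ω) :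
    P.beta h Cinv CΩ CC CT * P.quadEnergy φ 0 0 ≤ P.quadEnergy φ u θ := by
  have hK := couplingRatio_pos hpos hC hT hCΩ hh hCinv
  have h1 := couplingRatio_mul_elastic_le hpos hconf hC hT hCΩ hh hCinv hφ hk
  have h2 := le_Equad hT hC hpos.M φ u θ
  have h3 : 0 ≤ dualNorm P.Vf P.κ θ.1 ^ 2 / (2 * P.τ) :=
    div_nonneg (sq_nonneg _) (mul_nonneg two_pos.le hpos.τ.le)
  have h4 : dualNorm P.Vf P.κ (0 : FunGrad Ω).1 ^ 2 = 0 := dualNorm_zero_sq hpos.κ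
  rw [beta_eq hK, quadEnergy, quadEnergy, h4, Equad_phase hT hC, div_mul_eq_mul_div,
    div_le_iff₀ (by positivity)]
  set K := P.couplingRatio h Cinv CΩ CC CT
  have h5 := mul_le_mul_of_nonneg_left h2 (show 0 ≤ K + 1 by positivity)
  have h6 := mul_nonneg (show 0 ≤ K + 1 by positivity) h3
  rw [zero_div]
  linarith

/-- Relative coercivity of the joint energy with respect to the Biot energy. -/
lemma beta_mul_biot_le (u : VecFunGrad Ω) (θ : FunGrad Ω) :
    P.beta h Cinv CΩ CC CT * P.quadEnergy 0 u θ ≤ P.quadEnergy φ u θ := by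
  have hK := couplingRatio_pos hpos hC hT hCΩ hh hCinv
  have h1 := couplingRatio_mul_elastic_le hpos hconf hC hT hCΩ hh hCinv hφ hk
  have h2 := Equad_biot_le hT hC hpos.M hK φ u θ
  have h3 : 0 ≤ dualNorm P.Vf P.κ θ.1 ^ 2 / (2 * P.τ) :=
    div_nonneg (sq_nonneg _) (mul_nonneg two_pos.le hpos.τ.le)
  have h4 : dualNorm P.Vch P.m (0 : FunGrad Ω).1 ^ 2 = 0 := dualNorm_zero_sq hpos.m
  rw [beta_eq hK, quadEnergy, quadEnergy, h4, zero_div, zero_add, mul_add]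
  set K := P.couplingRatio h Cinv CΩ CC CT
  have h5 : K / (K + 1) ≤ 1 := by rw [div_le_one (by positivity)]; linarith
  have h6 := mul_le_mul_of_nonneg_right h5 h3
  linarith

/-- Smoothness of the energy in the phase field, relative to the phase-field energy. -/
lemma phase_add_le_Lch_mul (L : ℝ≥0) :
    P.quadEnergy φ 0 0 + P.γ / P.ℓ * (L / 2 * ‖φ.1‖ ^ 2) ≤
      P.Lch h Cinv CΩ cC cT L * P.quadEnergy φ 0 0 := by
  have h1 := le_diffusive_energy hpos hconf hCΩ hh hCinv hφ hk
  have h2 := le_elastic_eigenstrain hT hC φ.1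
  have h4 : dualNorm P.Vf P.κ (0 : FunGrad Ω).1 ^ 2 = 0 := dualNorm_zero_sq hpos.κ
  have h5 : P.quadEnergy φ 0 0 = dualNorm P.Vch P.m φ.1 ^ 2 / (2 * P.τ)
      + (P.γ * P.ℓ / 2 * ‖φ.2‖ ^ 2 + 1 / 2 * elastic (volume.restrict Ω) P.C
        (fun x => P.T (φ.1 x)) (fun x => P.T (φ.1 x))) := by
    rw [quadEnergy, h4, Equad_phase hT hC, zero_div, add_zero]
  have := hpos.τ
  have := hpos.γ
  have := hpos.ℓ
  have := hC.pos_lower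
  have := hT.pos_lower
  have := hCΩ.1
  have := hCinv.1
  rw [Lch]
  set c := 1 / P.τ * (h ^ 2 / Cinv ^ 2) + P.γ * P.ℓ * (1 / CΩ ^ 2) + cC * cT ^ 2 with hc
  have hc0 : 0 < c := by rw [hc]; positivity
  have h6 : c / 2 * ‖φ.1‖ ^ 2 ≤ P.quadEnergy φ 0 0 := by
    rw [h5, hc]; linarith
  have h7 : ‖φ.1‖ ^ 2 / 2 ≤ c⁻¹ * P.quadEnergy φ 0 0 := by
    rw [← div_eq_inv_mul, le_div_iff₀ hc0]; linarith
  have h8 := mul_le_mul_of_nonneg_left h7 (show 0 ≤ P.γ / P.ℓ * (L : ℝ) by positivity)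
  linarith

end

end Problem

end CHB

/-! ### The two substeps -/

namespace CHB.Problem

variable {d : ℕ} {Ω : Set (Pt d)} [IsFiniteMeasure (volume.restrict Ω)] {P : Problem Ω}
  {cC CC cT CT CΩ h Cinv : ℝ} {L : ℝ≥0}
  (hpos : P.PositiveParameters) (hconf : P.Conforming)
  (hΨ : PotentialAssumption P.Ψc P.Ψe L)
  (hC : StiffnessAssumption P.C cC CC) (hT : EigenstrainAssumption Ω P.T cT CT)
  (hCΩ : IsPoincareConstant Ω CΩ) (hh : 0 < h) (hCinv : IsInverseConstant P.Vch P.m h Cinv)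
  (hΩ : (volume.restrict Ω).real univ ≠ 0)

include hpos hconf hCΩ in
lemma exists_isPotentialOf_ch (s : L2 Ω ℝ) : ∃ g, IsPotentialOf P.Vch P.m s g :=
  have := hconf.fin_ch
  exists_isPotentialOf hconf.sub_ch hCΩ hpos.m s

include hpos hconf hCΩ in
lemma exists_isPotentialOf_f (s : L2 Ω ℝ) : ∃ g, IsPotentialOf P.Vf P.κ s g :=
  have := hconf.fin_f
  exists_isPotentialOf hconf.sub_f hCΩ hpos.κ s

include hpos hconf hΨ hC hT hCΩ hh hCinv hΩ

/-- Contraction of the Cahn-Hilliard step, started from a Biot-optimal state. -/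
lemma IsChStep.contraction {φ₀ θ₀ p₀ φ₁ μ₁ φs θs : FunGrad Ω} {u₀ us : VecFunGrad Ω}
    (hφ₀ : φ₀ ∈ P.VchBar) (hbiot : P.IsBiotStep φ₀ u₀ θ₀ p₀) (hch : P.IsChStep u₀ φ₁ μ₁)
    (hφs : φs ∈ P.VchBar) (hus : us ∈ P.Vu) (hθs : θs ∈ P.VfBar) :
    P.H φ₁ u₀ θ₀ - P.H φs us θs ≤
      (1 - P.beta h Cinv CΩ CC CT / P.Lch h Cinv CΩ cC cT L)
        * (P.H φ₀ u₀ θ₀ - P.H φs us θs) := by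
  have hτ := hpos.τ.ne'
  have hK := couplingRatio_pos hpos hC hT hCΩ hh hCinv
  have hβ : 0 ≤ P.beta h Cinv CΩ CC CT := by rw [beta_eq hK]; positivity
  have hΛ : 0 < P.Lch h Cinv CΩ cC cT L := by
    have := hpos.τ
    have := hpos.γ
    have := hpos.ℓ
    have := hC.pos_lower
    rw [Lch]
    positivity
  obtain ⟨g₀, hg₀⟩ := exists_isPotentialOf_ch hpos hconf hCΩ (φ₀.1 - P.φprev.1 - P.τ • P.R)
  obtain ⟨gθ, hgθ, hDb⟩ := hbiot.exists_biotDeriv_eq_zero hpos hconf hΩ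
  obtain ⟨g₁, hg₁, hDch⟩ := hch.exists_chDeriv_eq_zero hpos hconf hΩ
  have hδ : φs - φ₀ ∈ meanFree P.Vch := sub_mem_meanFree hτ hφs hφ₀
  have hδθ : θs - θ₀ ∈ meanFree P.Vf :=
    sub_mem_meanFree hτ hθs (hbiot.mem_VfBar hpos hconf)
  obtain ⟨k, hk⟩ := exists_isPotentialOf_ch hpos hconf hCΩ (φs - φ₀).1
  obtain ⟨kθ, hkθ⟩ := exists_isPotentialOf_f hpos hconf hCΩ (θs - θ₀).1
  have hDb' := hDb _ (sub_mem hus hbiot.u_mem) _ hδθ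
  have hk0 : IsPotentialOf P.Vf P.κ (0 : FunGrad Ω).1 0 := isPotentialOf_zero
  set t := P.beta h Cinv CΩ CC CT / P.Lch h Cinv CΩ cC cT L
  refine sub_le_of_block_step (a := P.chDeriv φ₀ u₀ g₀ (φs - φ₀))
    (N := P.quadEnergy (φs - φ₀) 0 0) hβ hΛ ?_ ?_
  · have h1 := (H_add_smul hpos hΨ hC hT u₀ (us - u₀) hg₀ hgθ hk hkθ 1).1
    simp only [one_smul, add_sub_cancel, hDb'] at h1
    have h2 := beta_mul_phase_le hpos hconf hC hT hCΩ hh hCinv hδ hk (us - u₀) (θs - θ₀)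
    linarith
  · -- `φ₁` minimizes `H (·, u₀, θ₀)`, so it beats the point at distance `t` towards `φs`.
    have hη : φ₀ + t • (φs - φ₀) - φ₁ ∈ meanFree P.Vch := by
      have h1 := mem_meanFreeSubmodule.2
        (sub_mem_meanFree hτ hφ₀ (hch.mem_VchBar hpos hconf))
      have h2 := add_mem h1 (Submodule.smul_mem _ t (mem_meanFreeSubmodule.2 hδ))
      rwa [sub_add_eq_add_sub] at h2
    obtain ⟨k₁, hk₁⟩ := exists_isPotentialOf_ch hpos hconf hCΩ (φ₀ + t • (φs - φ₀) - φ₁).1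
    have h1 := (H_add_smul hpos hΨ hC hT u₀ 0 hg₁ hgθ hk₁ hk0 1).1
    have h2 := (H_add_smul hpos hΨ hC hT u₀ 0 hg₀ hgθ hk hk0 t).2
    simp only [one_smul, add_sub_cancel, smul_zero, add_zero, biotDeriv_zero, hDch _ hη] at h1 h2
    have h3 := phase_add_le_Lch_mul hpos hconf hC hT hCΩ hh hCinv hδ hk L
    have h4 := mul_le_mul_of_nonneg_left h3 (sq_nonneg t)
    have h5 := quadEnergy_nonneg hpos hC hT (φ₀ + t • (φs - φ₀) - φ₁) 0 0
    linarith

/-- Contraction of the Biot step, started from a state whose phase field is optimal. In this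
block `H` is quadratic, so the smoothness constant is `1`. -/
lemma IsBiotStep.contraction {φ₁ μ₁ θ₀ θ₁ p₁ φs θs : FunGrad Ω} {u₀ u₁ us : VecFunGrad Ω}
    (hu₀ : u₀ ∈ P.Vu) (hθ₀ : θ₀ ∈ P.VfBar) (hch : P.IsChStep u₀ φ₁ μ₁)
    (hbiot : P.IsBiotStep φ₁ u₁ θ₁ p₁)
    (hφs : φs ∈ P.VchBar) (hus : us ∈ P.Vu) (hθs : θs ∈ P.VfBar) :
    P.H φ₁ u₁ θ₁ - P.H φs us θs ≤
      (1 - P.beta h Cinv CΩ CC CT) * (P.H φ₁ u₀ θ₀ - P.H φs us θs) := by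
  have hτ := hpos.τ.ne'
  have hK := couplingRatio_pos hpos hC hT hCΩ hh hCinv
  have hβ : 0 ≤ P.beta h Cinv CΩ CC CT := by rw [beta_eq hK]; positivity
  obtain ⟨g₀, hg₀⟩ := exists_isPotentialOf_f hpos hconf hCΩ (θ₀.1 - P.θprev.1 - P.τ • P.S)
  obtain ⟨g₁, hg₁, hDb⟩ := hbiot.exists_biotDeriv_eq_zero hpos hconf hΩ
  obtain ⟨gφ, hgφ, hDch⟩ := hch.exists_chDeriv_eq_zero hpos hconf hΩ
  have hδ : φs - φ₁ ∈ meanFree P.Vch :=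
    sub_mem_meanFree hτ hφs (hch.mem_VchBar hpos hconf)
  obtain ⟨k, hk⟩ := exists_isPotentialOf_ch hpos hconf hCΩ (φs - φ₁).1
  obtain ⟨kθ, hkθ⟩ := exists_isPotentialOf_f hpos hconf hCΩ (θs - θ₀).1
  have hk0 : IsPotentialOf P.Vch P.m (0 : FunGrad Ω).1 0 := isPotentialOf_zero
  have hn0 : ‖(0 : FunGrad Ω).1‖ = 0 := norm_zero
  have hDch' := hDch _ hδ
  set t := P.beta h Cinv CΩ CC CT
  rw [← div_one t]
  refine sub_le_of_block_step (a := P.biotDeriv φ₁ u₀ θ₀ g₀ (us - u₀) (θs - θ₀))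
    (N := P.quadEnergy 0 (us - u₀) (θs - θ₀)) hβ one_pos ?_ ?_
  · have h1 := (H_add_smul hpos hΨ hC hT u₀ (us - u₀) hgφ hg₀ hk hkθ 1).1
    simp only [one_smul, add_sub_cancel, hDch'] at h1
    have h2 := beta_mul_biot_le hpos hconf hC hT hCΩ hh hCinv hδ hk (us - u₀) (θs - θ₀)
    linarith
  · -- `(u₁, θ₁)` minimizes `H (φ₁, ·, ·)`, so it beats the point at distance `t` towards
    -- `(us, θs)`.
    rw [div_one]
    have hη : θ₀ + t • (θs - θ₀) - θ₁ ∈ meanFree P.Vf := by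
      have h1 := mem_meanFreeSubmodule.2
        (sub_mem_meanFree hτ hθ₀ (hbiot.mem_VfBar hpos hconf))
      have h2 := add_mem h1 (Submodule.smul_mem _ t
        (mem_meanFreeSubmodule.2 (sub_mem_meanFree hτ hθs hθ₀)))
      rwa [sub_add_eq_add_sub] at h2
    have hv : u₀ + t • (us - u₀) - u₁ ∈ P.Vu :=
      sub_mem (add_mem hu₀ (Submodule.smul_mem _ t (sub_mem hus hu₀))) hbiot.u_mem
    obtain ⟨k₁, hk₁⟩ := exists_isPotentialOf_f hpos hconf hCΩ (θ₀ + t • (θs - θ₀) - θ₁).1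
    have h1 := (H_add_smul hpos hΨ hC hT u₁ (u₀ + t • (us - u₀) - u₁) hgφ hg₁ hk0 hk₁ 1).1
    have h2 := (H_add_smul hpos hΨ hC hT u₀ (us - u₀) hgφ hg₀ hk0 hkθ t).2
    simp only [one_smul, add_sub_cancel, smul_zero, add_zero, chDeriv_zero, hDb _ hv _ hη,
      hn0] at h1 h2
    have h5 := quadEnergy_nonneg hpos hC hT 0 (u₀ + t • (us - u₀) - u₁)
      (θ₀ + t • (θs - θ₀) - θ₁)
    linarith

end CHB.Problem

end

theorem mainTheorem1 {d : ℕ} (Ω : Set (CHB.Pt d)) (hΩo : IsOpen Ω) (hΩc : IsConnected Ω)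
    (hΩb : Bornology.IsBounded Ω) (P : CHB.Problem Ω)
    (hpos : P.PositiveParameters) (hconf : P.Conforming)
    (L : ℝ≥0) (hΨ : CHB.PotentialAssumption P.Ψc P.Ψe L)
    (cC CC : ℝ) (hC : CHB.StiffnessAssumption P.C cC CC)
    (cT CT : ℝ) (hT : CHB.EigenstrainAssumption Ω P.T cT CT)
    (CΩ : ℝ) (hCΩ : CHB.IsPoincareConstant Ω CΩ)
    (h Cinv : ℝ) (hh : 0 < h) (hCinv : CHB.IsInverseConstant P.Vch P.m h Cinv)
    (φn : CHB.FunGrad Ω) (un : CHB.VecFunGrad Ω) (θn : CHB.FunGrad Ω)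
    (hmin : P.IsMinimizer φn un θn)
    (φ μ : ℕ → CHB.FunGrad Ω) (u : ℕ → CHB.VecFunGrad Ω) (θ p : ℕ → CHB.FunGrad Ω)
    (halt : P.IsAlternating φ μ u θ p) :
    ∀ i : ℕ, 1 ≤ i →
      (2 ≤ i ∨ (P.φprev ∈ P.VchBar ∧ ∃ q, P.IsBiotStep P.φprev P.uprev P.θprev q)) →
      P.H (φ i) (u i) (θ i) - P.H φn un θn ≤
        (1 - P.beta h Cinv CΩ CC CT / P.Lch h Cinv CΩ cC cT L)
          * (1 - P.beta h Cinv CΩ CC CT)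
          * (P.H (φ (i - 1)) (u (i - 1)) (θ (i - 1)) - P.H φn un θn) := by
  intro i hi hcase
  have : IsFiniteMeasure (volume.restrict Ω) :=
    ⟨by rw [Measure.restrict_apply_univ]; exact hΩb.measure_lt_top⟩
  have hΩ : (volume.restrict Ω).real univ ≠ 0 := by
    rw [measureReal_restrict_apply_univ]
    exact (ENNReal.toReal_pos (hΩo.measure_pos volume hΩc.nonempty).ne'
      hΩb.measure_lt_top.ne).ne'
  -- The state before the step is admissible and Biot-optimal.
  obtain ⟨hφ₀, q, hq⟩ : φ (i - 1) ∈ P.VchBar ∧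
      ∃ q, P.IsBiotStep (φ (i - 1)) (u (i - 1)) (θ (i - 1)) q := by
    rcases eq_or_lt_of_le hi with h1 | h1
    · subst h1
      rcases hcase with h2 | h2
      · omega
      · rwa [Nat.sub_self, halt.φ_init, halt.u_init, halt.θ_init]
    · exact ⟨(halt.ch (i - 1) (by omega)).mem_VchBar hpos hconf, _, halt.biot (i - 1) (by omega)⟩
  have h1 := (halt.ch i hi).contraction hpos hconf hΨ hC hT hCΩ hh hCinv hΩ hφ₀ hq
    hmin.φ_mem hmin.u_mem hmin.θ_mem
  have h2 := (halt.biot i hi).contraction hpos hconf hΨ hC hT hCΩ hh hCinv hΩ hq.u_mem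
    (hq.mem_VfBar hpos hconf) (halt.ch i hi) hmin.φ_mem hmin.u_mem hmin.θ_mem
  have hβ : 0 ≤ 1 - P.beta h Cinv CΩ CC CT := by
    have hK := CHB.Problem.couplingRatio_pos hpos hC hT hCΩ hh hCinv
    rw [CHB.Problem.beta_eq hK, sub_nonneg, div_le_one (by positivity)]
    linarith
  calc _ ≤ _ := h2
    _ ≤ _ := mul_le_mul_of_nonneg_left h1 hβ
    _ = _ := by ring
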